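/- Let $\mathcal A$ be a finite set and let $S,U,Z,W$ be random variables with values in standard Borel spaces $\mathcal S,\mathcal U,\mathcal Z,\mathcal W$, $A$ a random variable with values in $\mathcal A$, and $R(a)$, $a\in\mathcal A$, real random variables (the potential rewards), all defined on one standard Borel probability space. Let $R=\sum_{a\in\mathcal A}R(a)\mathbf 1\{A=a\}$ be the observed reward, and assume $E[R^2]<\infty$. Let $dw$ and $dz$ denote $\sigma$-finite reference measures on $\mathcal W$ and $\mathcal Z$. Statements "given $S=s,A=a$" refer to a regular conditional probability given $S=s$, $A=a$, and are required for every $a\in\mathcal A$ and almost every $s$ with respect to the law of $S$ given $A=a$ (nothing is required if $P(A=a)=0$). Equations conditional on $A=a$ are meant almost surely under $P(\cdot\mid A=a)$, and conditional expectations are means under regular conditional distributions. Write $\mu_{X\mid s,a}$ for the law of $X$ given $S=s,A=a$, and $K_{s,a}:L^2(\mu_{W\mid s,a})\to L^2(\mu_{Z\mid s,a})$, $K_{s,a}h=E[h(W)\mid Z=\cdot,S=s,A=a]$. Assume the following. Proximal assumptions: $R\perp Z\mid (S,U,A)$; $W\perp (Z,A)\mid (S,U)$ and $W\not\perp U\mid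 S$; and $R(a)\perp A\mid (S,U)$ for every $a\in\mathcal A$. Completeness, for given $(s,a)$ as above: for every measurable $g\in L^2(\mu_{U\mid s,a})$, $E[g(U)\mid Z,S=s,A=a]=0$ a.s. if and only if $g(U)=0$ a.s.; and for every measurable $g\in L^2(\mu_{Z\mid s,a})$, $E[g(Z)\mid W,S=s,A=a]=0$ a.s. if and only if $g(Z)=0$ a.s. (a.s. under the conditional probability given $S=s,A=a$). Regularity, for given $(s,a)$ as above: $(W,Z)$ has a density given $S=s,A=a$ with respect to $dw\,dz$, and the conditional densities satisfy $$\iint f_{W\mid Z,S,A}(w\mid z,s,a)\,f_{Z\mid W,S,A}(z\mid w,s,a)\,dw\,dz<\infty,\qquad \int E[R\mid Z=z,S=s,A=a]^2 f_{Z\mid S,A}(z\mid s,a)\,dz<\infty ,$$ and there is a countable (finite or infinite) singular system $(\lambda_\nu,\varphi_\nu,\psi_\nu)_\nu$ of $K_{s,a}$ (that is, $\lambda_\nu>0$, $(\varphi_\nu)$ and $(\psi_\nu)$ are orthonormal, $K_{s,a}\varphi_\nu=\lambda_\nu\psi_\nu$, $K_{s,a}^*\psi_\nu=\lambda_\nu\varphi_\nu$,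 and $K_{s,a}h=0$ whenever $h\perp\varphi_\nu$ for all $\nu$) with $$\sum_\nu\lambda_\nu^{-2}\,\bigl|\langle E[R\mid Z=\cdot,S=s,A=a],\psi_\nu\rangle_{L^2(\mu_{Z\mid s,a})}\bigr|^2<\infty .$$ Call a function $q:\mathcal W\times\mathcal A\times\mathcal S\to\mathbb R$, with $q(\cdot,a,\cdot)$ jointly measurable for every $a$, a solution if $q(\cdot,a,s)\in L^2(\mu_{W\mid s,a})$ for every $a$ and almost every $s$ (as above) and $$E[q(W,a,S)\mid Z,S,A=a]=E[R\mid Z,S,A=a]\qquad\text{for every }a\in\mathcal A. $$ Then a solution exists. Moreover, every solution $q$ is an outcome bridge function: for every $a\in\mathcal A$, $q(W,a,S)$ is conditionally integrable given $(U,S)$ under $P(\cdot\mid A=a)$, and $$E[q(W,a,S)\mid U,S,A=a]=E[R\mid U,S,A=a].$$ -/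

import Mathlib

open MeasureTheory ProbabilityTheory
open scoped ENNReal

noncomputable section

/-- The conditional mean `E[X | V = v]` of a real random variable `X` under `ν`: the mean of the
regular conditional distribution of `X` given `V = v`.  It agrees with Mathlib's conditional
expectation when `X` is integrable (`condMean_ae_eq_condExp`), and it also makes sense when `X` is
only conditionally integrable given `V`. -/
def condMean {Ω β : Type*} [MeasurableSpace Ω] [MeasurableSpace β]
    (ν : Measure Ω) [IsFiniteMeasure ν] (X : Ω → ℝ) (V : Ω → β) (v : β) : ℝ :=
  ∫ x, x ∂(condDistrib X V ν v)

theorem condMean_ae_eq_condExp {Ω β : Type*} [MeasurableSpace Ω] [mβ : MeasurableSpace β]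
    (ν : Measure Ω) [IsFiniteMeasure ν] {X : Ω → ℝ} {V : Ω → β} (hV : Measurable V)
    (hX : Integrable X ν) :
    (fun ω => condMean ν X V (V ω)) =ᵐ[ν] ν[X | mβ.comap V] :=
  (condExp_ae_eq_integral_condDistrib' hV hX).symm

/-- The composition `h ↦ h ∘ X`, from the square-integrable functions for the law of `X` to the
square-integrable random variables. -/
def pullL2 {Ω α : Type*} [MeasurableSpace Ω] [MeasurableSpace α]
    (ν : Measure Ω) {X : Ω → α} (hX : Measurable X) :
    Lp ℝ 2 (ν.map X) →L[ℝ] Lp ℝ 2 ν :=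
  (Lp.compMeasurePreservingₗᵢ ℝ X (hX.measurePreserving ν)).toContinuousLinearMap

/-- The conditional expectation operator `h ↦ E[h(X) | Y = ·]`, from the square-integrable
functions for the law of `X` to those for the law of `Y`, written as the composition with `X`
followed by the adjoint of the composition with `Y`.  See `condExpOp_ae_eq_condMean`. -/
def condExpOp {Ω α β : Type*} [MeasurableSpace Ω] [MeasurableSpace α] [MeasurableSpace β]
    (ν : Measure Ω) {X : Ω → α} {Y : Ω → β} (hX : Measurable X) (hY : Measurable Y) :
    Lp ℝ 2 (ν.map X) →L[ℝ] Lp ℝ 2 (ν.map Y) :=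
  (ContinuousLinearMap.adjoint (pullL2 ν hY)).comp (pullL2 ν hX)

theorem adjoint_condExpOp {Ω α β : Type*} [MeasurableSpace Ω] [MeasurableSpace α]
    [MeasurableSpace β] (ν : Measure Ω) {X : Ω → α} {Y : Ω → β}
    (hX : Measurable X) (hY : Measurable Y) :
    ContinuousLinearMap.adjoint (condExpOp ν hX hY) = condExpOp ν hY hX := by
  simp [condExpOp, ContinuousLinearMap.adjoint_comp]

theorem pullL2_coeFn {Ω α : Type*} [MeasurableSpace Ω] [MeasurableSpace α]
    (ν : Measure Ω) {X : Ω → α} (hX : Measurable X) (h : Lp ℝ 2 (ν.map X)) :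
    pullL2 ν hX h =ᵐ[ν] h ∘ X :=
  Lp.coeFn_compMeasurePreserving h (hX.measurePreserving ν)

theorem condExpOp_ae_eq_condMean {Ω α β : Type*} [MeasurableSpace Ω] [MeasurableSpace α]
    [MeasurableSpace β] (ν : Measure Ω) [IsFiniteMeasure ν] {X : Ω → α} {Y : Ω → β}
    (hX : Measurable X) (hY : Measurable Y) (h : Lp ℝ 2 (ν.map X)) :
    condExpOp ν hX hY h =ᵐ[ν.map Y] condMean ν (fun ω => h (X ω)) Y := by
  have hJ : Integrable (fun ω => h (X ω)) ν :=
    ((Lp.memLp h).comp_measurePreserving (hX.measurePreserving ν)).integrable (by norm_num)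
  have hc : (fun ω => condMean ν (fun ω => h (X ω)) Y (Y ω)) =ᵐ[ν] _ :=
    condMean_ae_eq_condExp ν hY hJ
  have hcm : StronglyMeasurable (condMean ν (fun ω => h (X ω)) Y) :=
    StronglyMeasurable.integral_condDistrib (f := fun p : β × ℝ => p.2)
      measurable_snd.stronglyMeasurable
  have hci : Integrable (condMean ν (fun ω => h (X ω)) Y) (ν.map Y) := by
    rw [integrable_map_measure hcm.aestronglyMeasurable hY.aemeasurable]
    exact (integrable_condExp (m := MeasurableSpace.comap Y inferInstance)).congr hc.symm
  refine Integrable.ae_eq_of_forall_setIntegral_eq _ _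
    ((Lp.memLp (condExpOp ν hX hY h)).integrable (by norm_num)) hci ?_
  intro B hB hBf
  have hYB : MeasurableSet[MeasurableSpace.comap Y inferInstance] (Y ⁻¹' B) := ⟨B, hB, rfl⟩
  have e1 : ∫ y in B, condMean ν (fun ω => h (X ω)) Y y ∂(ν.map Y)
      = ∫ ω in Y ⁻¹' B, h (X ω) ∂ν := by
    rw [setIntegral_map hB hcm.aestronglyMeasurable hY.aemeasurable,
      ← setIntegral_condExp hY.comap_le hJ hYB]
    exact integral_congr_ae (ae_restrict_of_ae hc)
  have hpull : pullL2 ν hY (indicatorConstLp 2 hB hBf.ne (1 : ℝ))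
      = indicatorConstLp 2 (hY hB) (measure_ne_top ν _) (1 : ℝ) :=
    Lp.indicatorConstLp_compMeasurePreserving hB hBf.ne 1 (hY.measurePreserving ν)
  have e2 : ∫ y in B, condExpOp ν hX hY h y ∂(ν.map Y) = ∫ ω in Y ⁻¹' B, h (X ω) ∂ν := by
    rw [← L2.inner_indicatorConstLp_one (𝕜 := ℝ) hB hBf.ne, condExpOp,
      ContinuousLinearMap.comp_apply, ContinuousLinearMap.adjoint_inner_right, hpull,
      L2.inner_indicatorConstLp_one]
    exact integral_congr_ae (ae_restrict_of_ae (pullL2_coeFn ν hX h))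
  rw [e1, e2]

/-- `(σ i, φ i, ψ i)` is a singular system of the bounded operator `T`: the singular values `σ i`
are positive, the families `φ` and `ψ` are orthonormal, `T φᵢ = σᵢ ψᵢ`, `T* ψᵢ = σᵢ φᵢ`, and the
orthogonal complement of the `φ i` is in the kernel of `T`. -/
structure IsSingularSystem {H₁ H₂ ι : Type*} [NormedAddCommGroup H₁] [InnerProductSpace ℝ H₁]
    [CompleteSpace H₁] [NormedAddCommGroup H₂] [InnerProductSpace ℝ H₂] [CompleteSpace H₂]
    (T : H₁ →L[ℝ] H₂) (σ : ι → ℝ) (φ : ι → H₁) (ψ : ι → H₂) : Prop where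
  pos : ∀ i, 0 < σ i
  orthonormal_left : Orthonormal ℝ φ
  orthonormal_right : Orthonormal ℝ ψ
  map_left : ∀ i, T (φ i) = σ i • ψ i
  adjoint_right : ∀ i, ContinuousLinearMap.adjoint T (ψ i) = σ i • φ i
  complete : ∀ h : H₁, (∀ i, inner ℝ (φ i) h = 0) → T h = 0

/-- The joint density of `(W, Z)` under `ν` with respect to the reference measure `lW ⊗ lZ`. -/
def jointDensity {Ω 𝒲 𝒵 : Type*} [MeasurableSpace Ω] [MeasurableSpace 𝒲] [MeasurableSpace 𝒵]
    (ν : Measure Ω) (W : Ω → 𝒲) (Z : Ω → 𝒵) (lW : Measure 𝒲) (lZ : Measure 𝒵)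
    (w : 𝒲) (z : 𝒵) : ℝ≥0∞ :=
  (ν.map fun ω => (W ω, Z ω)).rnDeriv (lW.prod lZ) (w, z)

/-- The marginal density of `Z`. -/
def densityZ {Ω 𝒲 𝒵 : Type*} [MeasurableSpace Ω] [MeasurableSpace 𝒲] [MeasurableSpace 𝒵]
    (ν : Measure Ω) (W : Ω → 𝒲) (Z : Ω → 𝒵) (lW : Measure 𝒲) (lZ : Measure 𝒵) (z : 𝒵) : ℝ≥0∞ :=
  ∫⁻ w, jointDensity ν W Z lW lZ w z ∂lW

/-- The marginal density of `W`. -/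
def densityW {Ω 𝒲 𝒵 : Type*} [MeasurableSpace Ω] [MeasurableSpace 𝒲] [MeasurableSpace 𝒵]
    (ν : Measure Ω) (W : Ω → 𝒲) (Z : Ω → 𝒵) (lW : Measure 𝒲) (lZ : Measure 𝒵) (w : 𝒲) : ℝ≥0∞ :=
  ∫⁻ z, jointDensity ν W Z lW lZ w z ∂lZ

/-- The conditional density of `W` at `w` given `Z = z`. -/
def densityWgivenZ {Ω 𝒲 𝒵 : Type*} [MeasurableSpace Ω] [MeasurableSpace 𝒲] [MeasurableSpace 𝒵]
    (ν : Measure Ω) (W : Ω → 𝒲) (Z : Ω → 𝒵) (lW : Measure 𝒲) (lZ : Measure 𝒵)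
    (w : 𝒲) (z : 𝒵) : ℝ≥0∞ :=
  jointDensity ν W Z lW lZ w z / densityZ ν W Z lW lZ z

/-- The conditional density of `Z` at `z` given `W = w`. -/
def densityZgivenW {Ω 𝒲 𝒵 : Type*} [MeasurableSpace Ω] [MeasurableSpace 𝒲] [MeasurableSpace 𝒵]
    (ν : Measure Ω) (W : Ω → 𝒲) (Z : Ω → 𝒵) (lW : Measure 𝒲) (lZ : Measure 𝒵)
    (z : 𝒵) (w : 𝒲) : ℝ≥0∞ :=
  jointDensity ν W Z lW lZ w z / densityW ν W Z lW lZ w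

/-- A confounded contextual bandit with proxies: on the probability space `(Ω, P)`, the observed
feature `S`, the latent feature `U`, the action proxy `Z`, the reward proxy `W`, the action `A`
and the potential rewards `Rpot a`. -/
structure ConfoundedBandit (Ω 𝒮 𝒰 𝒵 𝒲 𝒜 : Type*) [MeasurableSpace Ω] [MeasurableSpace 𝒮]
    [MeasurableSpace 𝒰] [MeasurableSpace 𝒵] [MeasurableSpace 𝒲] [MeasurableSpace 𝒜] where
  P : Measure Ω
  isProbabilityMeasure_P : IsProbabilityMeasure P
  S : Ω → 𝒮
  U : Ω → 𝒰
  Z : Ω → 𝒵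
  W : Ω → 𝒲
  A : Ω → 𝒜
  Rpot : 𝒜 → Ω → ℝ
  measurable_S : Measurable S
  measurable_U : Measurable U
  measurable_Z : Measurable Z
  measurable_W : Measurable W
  measurable_A : Measurable A
  measurable_Rpot : ∀ a, Measurable (Rpot a)

attribute [instance] ConfoundedBandit.isProbabilityMeasure_P

namespace ConfoundedBandit

variable {Ω 𝒮 𝒰 𝒵 𝒲 𝒜 : Type*} [MeasurableSpace Ω] [MeasurableSpace 𝒮]
    [MeasurableSpace 𝒰] [MeasurableSpace 𝒵] [MeasurableSpace 𝒲] [MeasurableSpace 𝒜]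

/-- The observed reward `R = ∑ₐ R(a) 1{A = a}`. -/
def R (M : ConfoundedBandit Ω 𝒮 𝒰 𝒵 𝒲 𝒜) (ω : Ω) : ℝ := M.Rpot (M.A ω) ω

/-- The conditional probability given `A = a` (the zero measure if `A = a` has probability `0`). -/
def PA (M : ConfoundedBandit Ω 𝒮 𝒰 𝒵 𝒲 𝒜) (a : 𝒜) : Measure Ω :=
  ProbabilityTheory.cond M.P (M.A ⁻¹' {a})

instance (M : ConfoundedBandit Ω 𝒮 𝒰 𝒵 𝒲 𝒜) (a : 𝒜) : IsFiniteMeasure (M.PA a) := by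
  unfold PA; infer_instance

/-- The regular conditional probability on `Ω` given `S = s` and `A = a`. -/
def PSA [StandardBorelSpace Ω] [Nonempty Ω] (M : ConfoundedBandit Ω 𝒮 𝒰 𝒵 𝒲 𝒜)
    (s : 𝒮) (a : 𝒜) : Measure Ω :=
  condDistrib (fun ω => ω) M.S (M.PA a) s

instance [StandardBorelSpace Ω] [Nonempty Ω] (M : ConfoundedBandit Ω 𝒮 𝒰 𝒵 𝒲 𝒜)
    (s : 𝒮) (a : 𝒜) : IsProbabilityMeasure (M.PSA s a) := by
  unfold PSA; infer_instance

/-- The proximal assumptions: `R ⟂ Z | (S, U, A)`; `W ⟂ (Z, A) | (S, U)`; `W` and `U` are not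
conditionally independent given `S`; and `R(a) ⟂ A | (S, U)` for every action `a`. -/
structure Proximal [StandardBorelSpace Ω] (M : ConfoundedBandit Ω 𝒮 𝒰 𝒵 𝒲 𝒜) : Prop where
  reward_indep : CondIndepFun
    (MeasurableSpace.comap (fun ω => (M.S ω, M.U ω, M.A ω)) inferInstance)
    (M.measurable_S.prodMk (M.measurable_U.prodMk M.measurable_A)).comap_le M.R M.Z M.P
  proxy_indep : CondIndepFun
    (MeasurableSpace.comap (fun ω => (M.S ω, M.U ω)) inferInstance)
    (M.measurable_S.prodMk M.measurable_U).comap_le M.W (fun ω => (M.Z ω, M.A ω)) M.P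
  proxy_relevant : ¬ CondIndepFun
    (MeasurableSpace.comap M.S inferInstance) M.measurable_S.comap_le M.W M.U M.P
  latent_unconfounded : ∀ a, CondIndepFun
    (MeasurableSpace.comap (fun ω => (M.S ω, M.U ω)) inferInstance)
    (M.measurable_S.prodMk M.measurable_U).comap_le (M.Rpot a) M.A M.P

/-- Completeness of `X` given `Y` under `ν`: for every square-integrable `g`,
`E[g(X) | Y] = 0` almost surely if and only if `g(X) = 0` almost surely. -/
def CompleteGiven {α β : Type*} [MeasurableSpace α] [MeasurableSpace β]
    (ν : Measure Ω) [IsFiniteMeasure ν] (X : Ω → α) (Y : Ω → β) : Prop :=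
  ∀ g : α → ℝ, Measurable g → MemLp g 2 (ν.map X) →
    ((condMean ν (fun ω => g (X ω)) Y =ᵐ[ν.map Y] 0) ↔ g =ᵐ[ν.map X] 0)

/-- The completeness assumption, for every action `a` and almost every `s` under the law of `S`
given `A = a`: `U` is complete given `Z`, and `Z` is complete given `W`, conditionally on
`S = s`, `A = a`. -/
structure Complete [StandardBorelSpace Ω] [Nonempty Ω]
    (M : ConfoundedBandit Ω 𝒮 𝒰 𝒵 𝒲 𝒜) : Prop where
  latent : ∀ a, ∀ᵐ s ∂((M.PA a).map M.S), CompleteGiven (M.PSA s a) M.U M.Z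
  proxy : ∀ a, ∀ᵐ s ∂((M.PA a).map M.S), CompleteGiven (M.PSA s a) M.Z M.W

/-- The operator `h ↦ E[h(W) | Z = ·, S = s, A = a]` between the spaces of square-integrable
functions for the conditional laws of `W` and of `Z` given `S = s`, `A = a`. -/
def K [StandardBorelSpace Ω] [Nonempty Ω] (M : ConfoundedBandit Ω 𝒮 𝒰 𝒵 𝒲 𝒜)
    (s : 𝒮) (a : 𝒜) :
    Lp ℝ 2 ((M.PSA s a).map M.W) →L[ℝ] Lp ℝ 2 ((M.PSA s a).map M.Z) :=
  condExpOp (M.PSA s a) M.measurable_W M.measurable_Z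

/-- The regularity conditions, with reference measures `lW` and `lZ` for the densities, for every
action `a` and almost every `s` under the law of `S` given `A = a`. -/
structure Regular [StandardBorelSpace Ω] [Nonempty Ω] (M : ConfoundedBandit Ω 𝒮 𝒰 𝒵 𝒲 𝒜)
    (lW : Measure 𝒲) (lZ : Measure 𝒵) : Prop where
  /-- The pair `(W, Z)` has a density given `S = s`, `A = a`. -/
  has_density : ∀ a, ∀ᵐ s ∂((M.PA a).map M.S),
    (M.PSA s a).map (fun ω => (M.W ω, M.Z ω)) ≪ lW.prod lZ
  /-- `∬ f(w | z, s, a) f(z | w, s, a) dw dz < ∞`. -/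
  density_product : ∀ a, ∀ᵐ s ∂((M.PA a).map M.S),
    ∫⁻ w, ∫⁻ z, densityWgivenZ (M.PSA s a) M.W M.Z lW lZ w z
      * densityZgivenW (M.PSA s a) M.W M.Z lW lZ z w ∂lZ ∂lW < ∞
  /-- `∫ E[R | Z = z, S = s, A = a]² f(z | s, a) dz < ∞`. -/
  reward_sq : ∀ a, ∀ᵐ s ∂((M.PA a).map M.S),
    ∫⁻ z, ENNReal.ofReal (condMean (M.PSA s a) M.R M.Z z ^ 2)
      * densityZ (M.PSA s a) M.W M.Z lW lZ z ∂lZ < ∞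
  /-- Picard's condition for some singular system of `K`. -/
  picard : ∀ a, ∀ᵐ s ∂((M.PA a).map M.S),
    ∃ (ι : Type) (_ : Countable ι) (σ : ι → ℝ) (φ : ι → Lp ℝ 2 ((M.PSA s a).map M.W))
      (ψ : ι → Lp ℝ 2 ((M.PSA s a).map M.Z)),
      IsSingularSystem (M.K s a) σ φ ψ ∧
      Summable fun i => (σ i)⁻¹ ^ 2 *
        |∫ z, condMean (M.PSA s a) M.R M.Z z * ψ i z ∂((M.PSA s a).map M.Z)| ^ 2

/-- `q` solves `E[q(W, a, S) | Z, S, A = a] = E[R | Z, S, A = a]` for every action `a`, with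
`q(·, a, s)` in the domain of `K s a`, that is, square-integrable for the conditional law of `W`
given `S = s`, `A = a`. -/
structure IsSolution [StandardBorelSpace Ω] [Nonempty Ω] (M : ConfoundedBandit Ω 𝒮 𝒰 𝒵 𝒲 𝒜)
    (q : 𝒲 → 𝒜 → 𝒮 → ℝ) : Prop where
  measurable : ∀ a, Measurable fun p : 𝒲 × 𝒮 => q p.1 a p.2
  sq_integrable : ∀ a, ∀ᵐ s ∂((M.PA a).map M.S),
    MemLp (fun w => q w a s) 2 ((M.PSA s a).map M.W)
  eqn : ∀ a,
    condMean (M.PA a) (fun ω => q (M.W ω) a (M.S ω)) (fun ω => (M.Z ω, M.S ω))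
      =ᵐ[(M.PA a).map (fun ω => (M.Z ω, M.S ω))]
    condMean (M.PA a) M.R (fun ω => (M.Z ω, M.S ω))

/-- `q` is an outcome bridge function: for every action `a`,
`E[q(W, a, S) | U, S, A = a] = E[R | U, S, A = a]`, where the left-hand side exists. -/
structure IsOutcomeBridge (M : ConfoundedBandit Ω 𝒮 𝒰 𝒵 𝒲 𝒜)
    (q : 𝒲 → 𝒜 → 𝒮 → ℝ) : Prop where
  measurable : ∀ a, Measurable fun p : 𝒲 × 𝒮 => q p.1 a p.2
  integrable : ∀ a, ∀ᵐ v ∂((M.PA a).map (fun ω => (M.U ω, M.S ω))),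
    Integrable (fun x : ℝ => x)
      (condDistrib (fun ω => q (M.W ω) a (M.S ω)) (fun ω => (M.U ω, M.S ω)) (M.PA a) v)
  eqn : ∀ a,
    condMean (M.PA a) (fun ω => q (M.W ω) a (M.S ω)) (fun ω => (M.U ω, M.S ω))
      =ᵐ[(M.PA a).map (fun ω => (M.U ω, M.S ω))]
    condMean (M.PA a) M.R (fun ω => (M.U ω, M.S ω))

end ConfoundedBandit

end

/-! Fix `a` and work under `P(· | A = a)`. In each fiber `S = s`, completeness of `Z` given `W`
makes the adjoint of `K s a` injective, so Picard's condition gives a solution of the fiber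
equation. These solutions must still be chosen measurably in `s`, and singular systems need not vary
measurably. The global operator `T : L²(W, S) → L²(Z, S)` is the direct integral of the fiber
operators (`fiberL2_condExpOp`), and Landweber's iteration commutes with restriction to fibers
(`fiberL2_landweber`). For a contraction with injective adjoint, bounded iterates force solvability
(`exists_apply_eq_of_landweber_bounded`), and solvability bounds them (`norm_landweber_apply_le`).
Solvable fibers therefore have bounded iterates, with a bound depending on `s` only. Rescaling the
right-hand side by a positive function of `S` makes the global iterates bounded. The global equation
is then solvable, and dividing by that function gives the required jointly measurable `q`
(`exists_condExpOp_ae_eq_mul`).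

For the bridge property, conditional independence makes the laws of `W` and of `R` given `(Z, U)` in
a fiber functions of `U` alone. By the tower property, `E[q | U] - E[R | U]` has conditional mean
zero given `Z`, so it vanishes by completeness of `U` given `Z`. -/

noncomputable section

/-! ### Solvability of operator equations: Picard and Landweber -/

section HilbertSpace

variable {H₁ H₂ : Type*} [NormedAddCommGroup H₁] [InnerProductSpace ℝ H₁] [CompleteSpace H₁]
  [NormedAddCommGroup H₂] [InnerProductSpace ℝ H₂] [CompleteSpace H₂]

/-- Picard's theorem, when the adjoint is injective. -/
theorem IsSingularSystem.exists_apply_eq {ι : Type*} {T : H₁ →L[ℝ] H₂} {σ : ι → ℝ} {φ : ι → H₁}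
    {ψ : ι → H₂} (h : IsSingularSystem T σ φ ψ)
    (hker : ∀ k, ContinuousLinearMap.adjoint T k = 0 → k = 0) (y : H₂)
    (hy : Summable fun i => (σ i)⁻¹ ^ 2 * |inner ℝ (ψ i) y| ^ 2) : ∃ x, T x = y := by
  classical
  -- Coefficients of the candidate solution; Picard's condition says exactly that they are
  -- square-summable.
  set c : ι → ℝ := fun i => (σ i)⁻¹ * inner ℝ (ψ i) y with hc
  have hsum : Summable fun i => c i • φ i := by
    have := (h.orthonormal_left.orthogonalFamily.summable_iff_norm_sq_summable c).2 (by
      refine hy.congr fun i => ?_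
      simp [hc, mul_pow])
    simpa using this
  set x := ∑' i, c i • φ i with hx
  have hinner : ∀ i, inner ℝ (φ i) x = c i := fun i => by
    have h1 : HasSum (fun j => inner ℝ (φ i) (c j • φ j)) (inner ℝ (φ i) x) :=
      hsum.hasSum.mapL (innerSL ℝ (φ i))
    refine h1.unique ?_
    have h2 : (fun j => inner ℝ (φ i) (c j • φ j)) = fun j => if j = i then c i else 0 := by
      ext j
      rw [inner_smul_right, orthonormal_iff_ite.1 h.orthonormal_left i j]
      by_cases hij : i = j
      · simp [hij]
      · simp [hij, Ne.symm hij]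
    rw [h2]
    exact hasSum_ite_eq i (c i)
  -- By injectivity of the adjoint, `u = T*(y - T x) = 0` suffices. The choice of `c` makes `u`
  -- orthogonal to every `φ i`, so `T u = 0` and `⟪u, u⟫ = ⟪y - T x, T u⟫ = 0`.
  refine ⟨x, (sub_eq_zero.1 (hker _ ?_)).symm⟩
  set u := ContinuousLinearMap.adjoint T (y - T x) with hu
  have hTu : T u = 0 := h.complete u fun i => by
    have : inner ℝ (φ i) u = σ i * (inner ℝ (ψ i) y) - σ i * (σ i * c i) := by
      rw [hu, ContinuousLinearMap.adjoint_inner_right, h.map_left, inner_smul_left,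
        inner_sub_right, ← ContinuousLinearMap.adjoint_inner_left, h.adjoint_right,
        inner_smul_left, hinner]
      simp [mul_sub]
    rw [this, hc]
    have := (h.pos i).ne'
    field_simp
    ring
  have : inner ℝ u u = 0 := by
    conv_lhs => rw [hu]
    rw [ContinuousLinearMap.adjoint_inner_left, ← hu, hTu, inner_zero_right]
  exact inner_self_eq_zero.1 this

/-- Landweber's iteration for the equation `T x = y`. -/
def landweber (T : H₁ →L[ℝ] H₂) (y : H₂) : ℕ → H₁
  | 0 => 0
  | n + 1 => landweber T y n + ContinuousLinearMap.adjoint T (y - T (landweber T y n))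

theorem landweber_smul (T : H₁ →L[ℝ] H₂) (c : ℝ) (y : H₂) (n : ℕ) :
    landweber T (c • y) n = c • landweber T y n := by
  induction n with
  | zero => simp [landweber]
  | succ n ih => simp [landweber, ih, smul_add, ← smul_sub]

theorem norm_sub_adjoint_apply_le {T : H₁ →L[ℝ] H₂} (hT : ‖T‖ ≤ 1) (v : H₁) :
    ‖v - ContinuousLinearMap.adjoint T (T v)‖ ≤ ‖v‖ := by
  refine (sq_le_sq₀ (norm_nonneg _) (norm_nonneg _)).1 ?_
  rw [norm_sub_sq_real, ContinuousLinearMap.adjoint_inner_right, real_inner_self_eq_norm_sq]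
  have h1 : ‖ContinuousLinearMap.adjoint T (T v)‖ ≤ ‖T v‖ := by
    refine (ContinuousLinearMap.le_opNorm _ _).trans ?_
    rw [LinearIsometryEquiv.norm_map]
    exact mul_le_of_le_one_left (norm_nonneg _) hT
  nlinarith [norm_nonneg (ContinuousLinearMap.adjoint T (T v)), norm_nonneg (T v)]

/-- The error `xₙ - x` is multiplied by the contraction `1 - T*T` at each step and starts at `-x`.
-/
theorem norm_landweber_apply_le {T : H₁ →L[ℝ] H₂} (hT : ‖T‖ ≤ 1) (x : H₁) (n : ℕ) :
    ‖landweber T (T x) n‖ ≤ 2 * ‖x‖ := by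
  have key : ‖landweber T (T x) n - x‖ ≤ ‖x‖ := by
    induction n with
    | zero => simp [landweber]
    | succ n ih =>
      refine le_trans ?_ ((norm_sub_adjoint_apply_le hT _).trans ih)
      apply le_of_eq
      congr 1
      simp only [landweber, map_sub]
      abel
  calc _ = ‖(landweber T (T x) n - x) + x‖ := by simp
    _ ≤ _ := norm_add_le _ _
    _ ≤ _ := by linarith

/-- If Landweber's iteration is bounded and the adjoint is injective, then the equation `T x = y`
is solvable. -/
theorem exists_apply_eq_of_landweber_bounded {T : H₁ →L[ℝ] H₂} (hT : ‖T‖ ≤ 1)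
    (hker : ∀ k, ContinuousLinearMap.adjoint T k = 0 → k = 0) (y : H₂) {C : ℝ}
    (hC : ∀ n, ‖landweber T y n‖ ≤ C) : ∃ x, T x = y := by
  -- `N` is symmetric and positive, and the iterates are the partial sums of `∑ N^k b`.
  set N : H₁ →L[ℝ] H₁ := 1 - (ContinuousLinearMap.adjoint T).comp T with hN
  set b := ContinuousLinearMap.adjoint T y with hb
  have hNsymm : ∀ v w, inner ℝ (N v) w = inner ℝ v (N w) := fun v w => by
    simp [hN, inner_sub_left, inner_sub_right, ContinuousLinearMap.adjoint_inner_left,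
      ContinuousLinearMap.adjoint_inner_right]
  have hNpos : ∀ v, 0 ≤ inner ℝ (N v) v := fun v => by
    have h1 : ‖T v‖ ≤ ‖v‖ := (T.le_opNorm v).trans (mul_le_of_le_one_left (norm_nonneg _) hT)
    have h2 : inner ℝ (N v) v = ‖v‖ ^ 2 - ‖T v‖ ^ 2 := by
      simp [hN, inner_sub_left, ContinuousLinearMap.adjoint_inner_left]
    rw [h2]
    nlinarith [norm_nonneg (T v)]
  have hsymm : ∀ j v w, inner ℝ ((N ^ j) v) w = inner ℝ v ((N ^ j) w) := fun j => by
    induction j with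
    | zero => simp
    | succ j ih =>
      intro v w
      rw [pow_succ, mul_apply_eq_comp, ih, hNsymm, ← mul_apply_eq_comp,
        ← pow_succ', pow_succ]
  -- The inner product depends on `j + k` only. If it is `2p` it equals `‖N^p b‖²`; if it is `2p +
  -- 1` it equals `⟪N (N^p b), N^p b⟫`.
  have hpos : ∀ k j, 0 ≤ inner ℝ ((N ^ k) b) ((N ^ j) b) := fun k j => by
    have e1 : inner ℝ ((N ^ k) b) ((N ^ j) b) = inner ℝ ((N ^ (j + k)) b) b := by
      rw [pow_add, mul_apply_eq_comp, hsymm j ((N ^ k) b)]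
    rw [e1]
    obtain ⟨p, hp | hp⟩ := Nat.even_or_odd' (j + k)
    · rw [hp, two_mul, pow_add, mul_apply_eq_comp, hsymm]
      exact real_inner_self_nonneg
    · rw [hp, two_mul, add_assoc, pow_add, mul_apply_eq_comp, hsymm, pow_succ',
        mul_apply_eq_comp]
      exact hNpos _
  have hsum : ∀ n, landweber T y n = ∑ k ∈ Finset.range n, (N ^ k) b := fun n => by
    induction n with
    | zero => simp [landweber]
    | succ n ih =>
      have : landweber T y (n + 1) = N (landweber T y n) + b := by
        simp [landweber, hN, hb]
        abel
      rw [this, ih, Finset.sum_range_succ', map_sum]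
      simp [pow_succ']
  -- Increments have nonnegative inner product with earlier iterates, so bounded norms make the
  -- sequence Cauchy.
  have hincr : ∀ n m, n ≤ m → ‖landweber T y m - landweber T y n‖ ^ 2
      ≤ ‖landweber T y m‖ ^ 2 - ‖landweber T y n‖ ^ 2 := fun n m hnm => by
    have h0 : 0 ≤ inner ℝ (landweber T y n) (landweber T y m - landweber T y n) := by
      rw [hsum, hsum, ← Finset.sum_Ico_eq_sub _ hnm, sum_inner]
      refine Finset.sum_nonneg fun i _ => ?_
      rw [inner_sum]
      exact Finset.sum_nonneg fun j _ => hpos _ _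
    have h1 : landweber T y m = landweber T y n + (landweber T y m - landweber T y n) := by abel
    have h2 := norm_add_sq_real (landweber T y n) (landweber T y m - landweber T y n)
    rw [← h1] at h2
    linarith
  have hmono : Monotone fun n => ‖landweber T y n‖ ^ 2 := fun n m hnm => by
    have := hincr n m hnm
    have := sq_nonneg ‖landweber T y m - landweber T y n‖
    simp only
    linarith
  have hbdd : BddAbove (Set.range fun n => ‖landweber T y n‖ ^ 2) :=
    ⟨C ^ 2, by rintro _ ⟨n, rfl⟩; exact pow_le_pow_left₀ (norm_nonneg _) (hC n) 2⟩
  have hcau : CauchySeq fun n => landweber T y n := by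
    have hc := (tendsto_atTop_ciSup hmono hbdd).cauchySeq
    rw [Metric.cauchySeq_iff'] at hc ⊢
    intro ε hε
    obtain ⟨n, hn⟩ := hc (ε ^ 2) (by positivity)
    refine ⟨n, fun m hm => ?_⟩
    have h1 := hn m hm
    rw [Real.dist_eq] at h1
    rw [dist_eq_norm]
    refine lt_of_pow_lt_pow_left₀ 2 hε.le ?_
    exact (hincr n m hm).trans_lt ((le_abs_self _).trans_lt h1)
  obtain ⟨x, hx⟩ := cauchySeq_tendsto_of_complete hcau
  refine ⟨x, (sub_eq_zero.1 (hker _ ?_)).symm⟩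
  -- The limit is a fixed point of the iteration, which means `T*(y - T x) = 0`.
  have l1 : Filter.Tendsto (fun n => landweber T y (n + 1)) Filter.atTop (nhds x) :=
    hx.comp (Filter.tendsto_add_atTop_nat 1)
  have l2 : Filter.Tendsto (fun n => landweber T y (n + 1)) Filter.atTop
      (nhds (x + ContinuousLinearMap.adjoint T (y - T x))) :=
    hx.add (((ContinuousLinearMap.adjoint T).continuous.tendsto _).comp
      (tendsto_const_nhds.sub ((T.continuous.tendsto _).comp hx)))
  simpa using tendsto_nhds_unique l2 l1

end HilbertSpace

/-! ### Disintegration over the values of `S` -/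

section Disintegration

variable {Ω 𝒮 β γ : Type*} [MeasurableSpace Ω] [StandardBorelSpace Ω] [Nonempty Ω]
  [MeasurableSpace 𝒮] [MeasurableSpace β] [MeasurableSpace γ]

/-- The regular conditional probability on `Ω` given `S = s`. -/
abbrev fiberMeasure (ν : Measure Ω) [IsFiniteMeasure ν] (S : Ω → 𝒮) (s : 𝒮) : Measure Ω :=
  condDistrib (fun ω => ω) S ν s

variable {ν : Measure Ω} [IsFiniteMeasure ν] {S : Ω → 𝒮}

theorem map_prodMk_eq_compProd_fiberMeasure (hS : Measurable S) {V : Ω → β} (hV : Measurable V) :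
    ν.map (fun ω => (S ω, V ω)) = ν.map S ⊗ₘ (condDistrib (fun ω => ω) S ν).map V := by
  rw [Measure.compProd_map hV, compProd_map_condDistrib (by fun_prop),
    Measure.map_map (by fun_prop) (by fun_prop)]
  rfl

theorem lintegral_map_prodMk_fiberMeasure (hS : Measurable S) {V : Ω → β} (hV : Measurable V)
    {f : β × 𝒮 → ℝ≥0∞} (hf : Measurable f) :
    ∫⁻ v, f v ∂(ν.map fun ω => (V ω, S ω))
      = ∫⁻ s, ∫⁻ x, f (x, s) ∂((fiberMeasure ν S s).map V) ∂(ν.map S) := by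
  have h1 : ∫⁻ v, f v ∂(ν.map fun ω => (V ω, S ω))
      = ∫⁻ v, f v.swap ∂(ν.map fun ω => (S ω, V ω)) := by
    rw [lintegral_map hf (by fun_prop), lintegral_map (by fun_prop) (by fun_prop)]
    rfl
  rw [h1, map_prodMk_eq_compProd_fiberMeasure hS hV, Measure.lintegral_compProd (by fun_prop)]
  simp [Kernel.map_apply _ hV]

theorem ae_ae_of_ae_map_prodMk (hS : Measurable S) {V : Ω → β} (hV : Measurable V)
    {p : β × 𝒮 → Prop} (h : ∀ᵐ v ∂(ν.map fun ω => (V ω, S ω)), p v) :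
    ∀ᵐ s ∂(ν.map S), ∀ᵐ x ∂((fiberMeasure ν S s).map V), p (x, s) := by
  have h1 : ν.map (fun ω => (V ω, S ω)) = (ν.map fun ω => (S ω, V ω)).map Prod.swap := by
    rw [Measure.map_map (by fun_prop) (by fun_prop)]
    rfl
  rw [h1] at h
  have h2 := ae_of_ae_map (by fun_prop) h
  rw [map_prodMk_eq_compProd_fiberMeasure hS hV] at h2
  filter_upwards [Measure.ae_ae_of_ae_compProd h2] with s hs
  rwa [Kernel.map_apply _ hV] at hs

theorem ae_map_prodMk_iff (hS : Measurable S) {V : Ω → β} (hV : Measurable V)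
    {p : β × 𝒮 → Prop} (hp : MeasurableSet {v | p v}) :
    (∀ᵐ v ∂(ν.map fun ω => (V ω, S ω)), p v) ↔
      ∀ᵐ s ∂(ν.map S), ∀ᵐ x ∂((fiberMeasure ν S s).map V), p (x, s) := by
  refine ⟨ae_ae_of_ae_map_prodMk hS hV, fun h => ?_⟩
  have hsw : MeasurableSet {v : 𝒮 × β | p v.swap} := measurable_swap hp
  have h2 : ∀ᵐ v ∂(ν.map fun ω => (S ω, V ω)), p v.swap := by
    rw [map_prodMk_eq_compProd_fiberMeasure hS hV]
    refine Measure.ae_compProd_of_ae_ae hsw ?_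
    filter_upwards [h] with s hs
    rw [Kernel.map_apply _ hV]
    exact hs
  rw [ae_map_iff (by fun_prop) hsw] at h2
  rwa [ae_map_iff (by fun_prop) hp]

theorem ae_ae_fiberMeasure_eq [MeasurableEq 𝒮] (hS : Measurable S) :
    ∀ᵐ s ∂(ν.map S), ∀ᵐ ω ∂(fiberMeasure ν S s), S ω = s := by
  have h : ∀ᵐ v ∂(ν.map fun ω => (ω, S ω)), S v.1 = v.2 := by
    rw [ae_map_iff (by fun_prop) (measurableSet_eq_fun (by fun_prop) (by fun_prop))]
    simp
  have := ae_ae_of_ae_map_prodMk hS measurable_id h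
  simpa using this

/-- Conditioning in stages: uniqueness of disintegrations is applied first over `S`, then inside the
fiber. -/
theorem condDistrib_ae_eq_condDistrib_fiberMeasure [MeasurableSpace.CountablyGenerated β]
    [StandardBorelSpace γ] [Nonempty γ] (hS : Measurable S) {V : Ω → β} (hV : Measurable V)
    {X : Ω → γ} (hX : Measurable X) :
    ∀ᵐ s ∂(ν.map S), ∀ᵐ v ∂((fiberMeasure ν S s).map V),
      condDistrib X (fun ω => (V ω, S ω)) ν (v, s) = condDistrib X V (fiberMeasure ν S s) v := by
  set κ : Kernel (𝒮 × β) γ :=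
    (condDistrib X (fun ω => (V ω, S ω)) ν).comap Prod.swap measurable_swap with hκ
  set η := condDistrib (fun ω => ω) S ν with hη
  -- Both sides are the joint law of `(S, V, X)`.
  have h : ν.map S ⊗ₘ η.map (fun ω => (V ω, X ω)) = ν.map S ⊗ₘ (η.map V ⊗ₖ κ) := by
    have : IsMarkovKernel (η.map V) := Kernel.IsMarkovKernel.map _ hV
    refine Measure.ext_of_lintegral _ fun f hf => ?_
    rw [← map_prodMk_eq_compProd_fiberMeasure hS (by fun_prop), lintegral_map hf (by fun_prop),
      Measure.lintegral_compProd hf]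
    have e1 : ∀ s, ∫⁻ x, f (s, x) ∂((η.map V ⊗ₖ κ) s)
        = ∫⁻ v, ∫⁻ x, f (s, v, x) ∂(condDistrib X (fun ω => (V ω, S ω)) ν (v, s))
          ∂((fiberMeasure ν S s).map V) := fun s => by
      rw [Kernel.lintegral_compProd _ _ _ (by fun_prop), Kernel.map_apply _ hV]
      rfl
    simp_rw [e1]
    rw [← lintegral_map_prodMk_fiberMeasure hS hV
      (f := fun p => ∫⁻ x, f (p.2, p.1, x) ∂(condDistrib X (fun ω => (V ω, S ω)) ν p))
      (Measurable.lintegral_kernel_prod_right' (f := fun q : (β × 𝒮) × γ => f (q.1.2, q.1.1, q.2))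
        (by fun_prop)),
      ← Measure.lintegral_compProd (f := fun q : (β × 𝒮) × γ => f (q.1.2, q.1.1, q.2))
        (by fun_prop), compProd_map_condDistrib (by fun_prop), lintegral_map (by fun_prop)
        (by fun_prop)]
  filter_upwards [Kernel.ae_eq_of_compProd_eq h] with s hs
  have h3 : (fiberMeasure ν S s).map (fun ω => (V ω, X ω))
      = (fiberMeasure ν S s).map V ⊗ₘ κ.sectR s := by
    rw [Kernel.map_apply _ (by fun_prop), Kernel.compProd_apply_eq_compProd_sectR,
      Kernel.map_apply _ hV] at hs
    exact hs
  filter_upwards [condDistrib_ae_eq_of_measure_eq_compProd V hX.aemeasurable h3] with v hv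
  rw [hv]
  rfl

/-- The fiber measure is carried by `{S = s}`, so `S` can be frozen at `s` inside `f`. -/
theorem condDistrib_comp_ae_eq_condDistrib_fiberMeasure {α : Type*} [MeasurableSpace α]
    [MeasurableSpace.CountablyGenerated β] [MeasurableEq 𝒮] [StandardBorelSpace γ] [Nonempty γ]
    (hS : Measurable S) {V : Ω → β} (hV : Measurable V) {Y : Ω → α} (hY : Measurable Y)
    {f : α × 𝒮 → γ} (hf : Measurable f) :
    ∀ᵐ s ∂(ν.map S), ∀ᵐ v ∂((fiberMeasure ν S s).map V),
      condDistrib (fun ω => f (Y ω, S ω)) (fun ω => (V ω, S ω)) ν (v, s)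
        = condDistrib (fun ω => f (Y ω, s)) V (fiberMeasure ν S s) v := by
  filter_upwards [condDistrib_ae_eq_condDistrib_fiberMeasure (ν := ν) hS hV
    (X := fun ω => f (Y ω, S ω)) (by fun_prop), ae_ae_fiberMeasure_eq hS] with s h1 h2
  filter_upwards [h1] with v hv
  rw [hv, condDistrib_congr_left (Y' := fun ω => f (Y ω, s))]
  filter_upwards [h2] with ω hω
  rw [hω]

theorem condMean_ae_eq_condMean_fiberMeasure {α : Type*} [MeasurableSpace α]
    [MeasurableSpace.CountablyGenerated β] [MeasurableEq 𝒮]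
    (hS : Measurable S) {V : Ω → β} (hV : Measurable V) {Y : Ω → α} (hY : Measurable Y)
    {f : α × 𝒮 → ℝ} (hf : Measurable f) :
    ∀ᵐ s ∂(ν.map S), ∀ᵐ v ∂((fiberMeasure ν S s).map V),
      condMean ν (fun ω => f (Y ω, S ω)) (fun ω => (V ω, S ω)) (v, s)
        = condMean (fiberMeasure ν S s) (fun ω => f (Y ω, s)) V v := by
  filter_upwards [condDistrib_comp_ae_eq_condDistrib_fiberMeasure (ν := ν) hS hV hY hf] with s hs
  filter_upwards [hs] with v hv
  rw [condMean, condMean, hv]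

end Disintegration

/-! ### Basic properties of conditional means and their operators -/

theorem measurable_condMean {Ω β : Type*} [MeasurableSpace Ω] [MeasurableSpace β]
    (ν : Measure Ω) [IsFiniteMeasure ν] (X : Ω → ℝ) (V : Ω → β) : Measurable (condMean ν X V) :=
  (StronglyMeasurable.integral_condDistrib (f := fun p : β × ℝ => p.2)
    measurable_snd.stronglyMeasurable).measurable

theorem condMean_congr {Ω β : Type*} [MeasurableSpace Ω] [MeasurableSpace β]
    {ν : Measure Ω} [IsFiniteMeasure ν] {X X' : Ω → ℝ} (h : X =ᵐ[ν] X') (V : Ω → β) :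
    condMean ν X V = condMean ν X' V := by
  ext v
  rw [condMean, condMean, condDistrib_congr_left h]

theorem norm_condExpOp_le {Ω α β : Type*} [MeasurableSpace Ω] [MeasurableSpace α]
    [MeasurableSpace β] (ν : Measure Ω) {X : Ω → α} {Y : Ω → β}
    (hX : Measurable X) (hY : Measurable Y) : ‖condExpOp ν hX hY‖ ≤ 1 := by
  have h1 : ‖pullL2 ν hX‖ ≤ 1 := LinearIsometry.norm_toContinuousLinearMap_le _
  have h2 : ‖pullL2 ν hY‖ ≤ 1 := LinearIsometry.norm_toContinuousLinearMap_le _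
  refine (ContinuousLinearMap.opNorm_comp_le _ _).trans ?_
  rw [LinearIsometryEquiv.norm_map]
  exact mul_le_one₀ h2 (norm_nonneg _) h1

/-! ### Square-integrable functions as direct integrals over fibers -/

section FiberL2

variable {Ω 𝒮 α β : Type*} [MeasurableSpace Ω] [StandardBorelSpace Ω] [Nonempty Ω]
  [MeasurableSpace 𝒮] [MeasurableSpace α] [MeasurableSpace β]
  {ν : Measure Ω} [IsFiniteMeasure ν] {S : Ω → 𝒮}

theorem memLp_two_iff_lintegral {μ : Measure α} {f : α → ℝ} (hf : Measurable f) :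
    MemLp f 2 μ ↔ ∫⁻ x, ‖f x‖ₑ ^ 2 ∂μ < ∞ := by
  rw [MemLp, eLpNorm_lt_top_iff_lintegral_rpow_enorm_lt_top (by simp) (by simp)]
  simp [hf.aestronglyMeasurable]

theorem enorm_sq_eq_lintegral {μ : Measure α} (h : Lp ℝ 2 μ) :
    ‖h‖ₑ ^ 2 = ∫⁻ x, ‖h x‖ₑ ^ 2 ∂μ := by
  rw [Lp.enorm_def, eLpNorm_eq_lintegral_rpow_enorm_toReal (by simp) (by simp),
    ← ENNReal.rpow_natCast, ← ENNReal.rpow_mul]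
  simp

theorem ae_memLp_fiberMeasure (hS : Measurable S) {V : Ω → β} (hV : Measurable V)
    {f : β × 𝒮 → ℝ} (hm : Measurable f) (hf : MemLp f 2 (ν.map fun ω => (V ω, S ω))) :
    ∀ᵐ s ∂(ν.map S), MemLp (fun x => f (x, s)) 2 ((fiberMeasure ν S s).map V) := by
  have h1 := (memLp_two_iff_lintegral hm).1 hf
  rw [lintegral_map_prodMk_fiberMeasure hS hV (by fun_prop)] at h1
  have h2 : Measurable fun s => ∫⁻ x, ‖f (x, s)‖ₑ ^ 2 ∂((fiberMeasure ν S s).map V) := by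
    simp_rw [← Kernel.map_apply _ hV]
    exact Measurable.lintegral_kernel_prod_right' (f := fun q : 𝒮 × β => ‖f (q.2, q.1)‖ₑ ^ 2)
      (by fun_prop)
  filter_upwards [ae_lt_top h2 h1.ne] with s hs
  exact (memLp_two_iff_lintegral (by fun_prop)).2 hs

open Classical in
/-- The restriction of a square-integrable function of `(V, S)` to the fiber `S = s`. -/
def fiberL2 {V : Ω → β} (h : Lp ℝ 2 (ν.map fun ω => (V ω, S ω))) (s : 𝒮) :
    Lp ℝ 2 ((fiberMeasure ν S s).map V) :=
  -- The default `0` is used only on a null set of `s`, by `ae_memLp_fiberMeasure`.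
  if hs : MemLp (fun x => h (x, s)) 2 ((fiberMeasure ν S s).map V) then hs.toLp _ else 0

theorem fiberL2_ae_eq (hS : Measurable S) {V : Ω → β} (hV : Measurable V)
    (h : Lp ℝ 2 (ν.map fun ω => (V ω, S ω))) :
    ∀ᵐ s ∂(ν.map S), fiberL2 h s =ᵐ[(fiberMeasure ν S s).map V] fun x => h (x, s) := by
  filter_upwards [ae_memLp_fiberMeasure hS hV (Lp.stronglyMeasurable h).measurable (Lp.memLp h)]
    with s hs
  rw [fiberL2, dif_pos hs]
  exact hs.coeFn_toLp

theorem fiberL2_of_ae_eq (hS : Measurable S) {V : Ω → β} (hV : Measurable V)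
    (h : Lp ℝ 2 (ν.map fun ω => (V ω, S ω))) {f : β × 𝒮 → ℝ}
    (hf : h =ᵐ[ν.map fun ω => (V ω, S ω)] f) :
    ∀ᵐ s ∂(ν.map S), fiberL2 h s =ᵐ[(fiberMeasure ν S s).map V] fun x => f (x, s) := by
  filter_upwards [fiberL2_ae_eq hS hV h, ae_ae_of_ae_map_prodMk hS hV hf] with s h1 h2
  exact h1.trans h2

theorem fiberL2_zero (hS : Measurable S) {V : Ω → β} (hV : Measurable V) :
    ∀ᵐ s ∂(ν.map S), fiberL2 (0 : Lp ℝ 2 (ν.map fun ω => (V ω, S ω))) s = 0 := by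
  filter_upwards [fiberL2_of_ae_eq hS hV 0 (Lp.coeFn_zero _ _ _)] with s hs
  exact Lp.ext (hs.trans (Lp.coeFn_zero _ _ _).symm)

theorem fiberL2_add (hS : Measurable S) {V : Ω → β} (hV : Measurable V)
    (h k : Lp ℝ 2 (ν.map fun ω => (V ω, S ω))) :
    ∀ᵐ s ∂(ν.map S), fiberL2 (h + k) s = fiberL2 h s + fiberL2 k s := by
  filter_upwards [fiberL2_of_ae_eq hS hV _ (Lp.coeFn_add h k), fiberL2_ae_eq hS hV h,
    fiberL2_ae_eq hS hV k] with s h1 h2 h3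
  refine Lp.ext (h1.trans ?_)
  filter_upwards [h2, h3, Lp.coeFn_add (fiberL2 h s) (fiberL2 k s)] with x e2 e3 e4
  rw [e4, Pi.add_apply, Pi.add_apply, e2, e3]

theorem fiberL2_sub (hS : Measurable S) {V : Ω → β} (hV : Measurable V)
    (h k : Lp ℝ 2 (ν.map fun ω => (V ω, S ω))) :
    ∀ᵐ s ∂(ν.map S), fiberL2 (h - k) s = fiberL2 h s - fiberL2 k s := by
  filter_upwards [fiberL2_of_ae_eq hS hV _ (Lp.coeFn_sub h k), fiberL2_ae_eq hS hV h,
    fiberL2_ae_eq hS hV k] with s h1 h2 h3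
  refine Lp.ext (h1.trans ?_)
  filter_upwards [h2, h3, Lp.coeFn_sub (fiberL2 h s) (fiberL2 k s)] with x e2 e3 e4
  rw [e4, Pi.sub_apply, Pi.sub_apply, e2, e3]

theorem enorm_fiberL2_sq (hS : Measurable S) {V : Ω → β} (hV : Measurable V)
    (h : Lp ℝ 2 (ν.map fun ω => (V ω, S ω))) :
    ∀ᵐ s ∂(ν.map S),
      ‖fiberL2 h s‖ₑ ^ 2 = ∫⁻ x, ‖h (x, s)‖ₑ ^ 2 ∂((fiberMeasure ν S s).map V) := by
  filter_upwards [fiberL2_ae_eq hS hV h] with s hs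
  rw [enorm_sq_eq_lintegral]
  refine lintegral_congr_ae ?_
  filter_upwards [hs] with x hx
  rw [hx]

theorem lintegral_enorm_fiberL2_sq (hS : Measurable S) {V : Ω → β} (hV : Measurable V)
    (h : Lp ℝ 2 (ν.map fun ω => (V ω, S ω))) :
    ‖h‖ₑ ^ 2 = ∫⁻ s, ‖fiberL2 h s‖ₑ ^ 2 ∂(ν.map S) := by
  have hm : Measurable h := (Lp.stronglyMeasurable h).measurable
  rw [enorm_sq_eq_lintegral, lintegral_map_prodMk_fiberMeasure hS hV (by fun_prop)]
  refine lintegral_congr_ae ?_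
  filter_upwards [enorm_fiberL2_sq hS hV h] with s hs
  rw [hs]

variable [MeasurableEq 𝒮] [MeasurableSpace.CountablyGenerated β]

/-- Conditioning on `(Y, S)` and then setting `S = s` is conditioning on `Y` in the fiber, so the
operator acts fiberwise. -/
theorem fiberL2_condExpOp (hS : Measurable S) {X : Ω → α} {Y : Ω → β} (hX : Measurable X)
    (hY : Measurable Y) (h : Lp ℝ 2 (ν.map fun ω => (X ω, S ω))) :
    ∀ᵐ s ∂(ν.map S), fiberL2 (condExpOp ν (hX.prodMk hS) (hY.prodMk hS) h) s
      = condExpOp (fiberMeasure ν S s) hX hY (fiberL2 h s) := by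
  have hm : Measurable h := (Lp.stronglyMeasurable h).measurable
  filter_upwards [fiberL2_of_ae_eq hS hY _
    (condExpOp_ae_eq_condMean ν (hX.prodMk hS) (hY.prodMk hS) h), fiberL2_ae_eq hS hX h,
    condMean_ae_eq_condMean_fiberMeasure (ν := ν) hS hY hX hm] with s h1 h2 h3
  refine Lp.ext (h1.trans ?_)
  filter_upwards [h3, condExpOp_ae_eq_condMean (fiberMeasure ν S s) hX hY (fiberL2 h s)]
    with y e3 e4
  rw [e3, e4, condMean_congr (ae_of_ae_map hX.aemeasurable h2)]

/-- The adjoint is again a conditional expectation operator, so each operation of the iteration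
passes to almost every fiber. -/
theorem fiberL2_landweber [MeasurableSpace.CountablyGenerated α] (hS : Measurable S)
    {X : Ω → α} {Y : Ω → β} (hX : Measurable X) (hY : Measurable Y) (y : Lp ℝ 2 (ν.map fun ω => (Y ω, S ω))) (n : ℕ) :
    ∀ᵐ s ∂(ν.map S), fiberL2 (landweber (condExpOp ν (hX.prodMk hS) (hY.prodMk hS)) y n) s
      = landweber (condExpOp (fiberMeasure ν S s) hX hY) (fiberL2 y s) n := by
  induction n with
  | zero => exact fiberL2_zero hS hX
  | succ n ih =>
    simp only [landweber, adjoint_condExpOp]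
    set T := condExpOp ν (hX.prodMk hS) (hY.prodMk hS) with hT
    filter_upwards [ih, fiberL2_add hS hX (landweber T y n)
      (condExpOp ν (hY.prodMk hS) (hX.prodMk hS) (y - T (landweber T y n))),
      fiberL2_condExpOp hS hY hX (y - T (landweber T y n)),
      fiberL2_sub hS hY y (T (landweber T y n)),
      fiberL2_condExpOp hS hX hY (landweber T y n)] with s e1 e2 e3 e4 e5
    rw [e2, e3, e4, e5, e1]

theorem condExpOp_injective_of_fiber (hS : Measurable S) {X : Ω → α} {Y : Ω → β}
    (hX : Measurable X) (hY : Measurable Y)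
    (hinj : ∀ᵐ s ∂(ν.map S), ∀ k, condExpOp (fiberMeasure ν S s) hX hY k = 0 → k = 0)
    (k : Lp ℝ 2 (ν.map fun ω => (X ω, S ω)))
    (hk : condExpOp ν (hX.prodMk hS) (hY.prodMk hS) k = 0) : k = 0 := by
  have h0 : ‖k‖ₑ ^ 2 = 0 := by
    rw [lintegral_enorm_fiberL2_sq hS hX]
    refine (lintegral_congr_ae ?_).trans lintegral_zero
    have h1 := fiberL2_condExpOp hS hX hY k
    rw [hk] at h1
    filter_upwards [hinj, h1, fiberL2_zero (ν := ν) hS hY] with s e1 e2 e3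
    rw [e1 _ (e2.symm.trans e3)]
    simp
  simpa using h0

end FiberL2

/-! ### Gluing the fiber solutions measurably -/

section Existence

variable {Ω 𝒮 α β : Type*} [MeasurableSpace Ω] [StandardBorelSpace Ω] [Nonempty Ω]
  [MeasurableSpace 𝒮] [MeasurableEq 𝒮] [MeasurableSpace α] [MeasurableSpace.CountablyGenerated α]
  [MeasurableSpace β] [MeasurableSpace.CountablyGenerated β]
  {ν : Measure Ω} [IsFiniteMeasure ν] {S : Ω → 𝒮}

/-- If the equation `K x = y` is solvable in almost every fiber, then it is globally solvable
after rescaling `y` by a positive function of `S`. -/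
theorem exists_condExpOp_ae_eq_mul (hS : Measurable S) {X : Ω → α} {Y : Ω → β}
    (hX : Measurable X) (hY : Measurable Y) (y : Lp ℝ 2 (ν.map fun ω => (Y ω, S ω)))
    (hinj : ∀ᵐ s ∂(ν.map S), ∀ k, condExpOp (fiberMeasure ν S s) hY hX k = 0 → k = 0)
    (hsolv : ∀ᵐ s ∂(ν.map S), ∃ x, condExpOp (fiberMeasure ν S s) hX hY x = fiberL2 y s) :
    ∃ g : 𝒮 → ℝ, Measurable g ∧ (∀ s, 0 < g s) ∧
      ∃ x, condExpOp ν (hX.prodMk hS) (hY.prodMk hS) x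
        =ᵐ[ν.map fun ω => (Y ω, S ω)] fun p => g p.2 * y p := by
  set T := condExpOp ν (hX.prodMk hS) (hY.prodMk hS) with hT
  -- The fiberwise bound on the iterates. Written through the global iterates, it is a countable
  -- supremum of measurable functions of `s`.
  set C : 𝒮 → ℝ≥0∞ := fun s =>
    ⨆ n, ∫⁻ x, ‖landweber T y n (x, s)‖ₑ ^ 2 ∂((fiberMeasure ν S s).map X) with hC
  have hCm : Measurable C := by
    refine Measurable.iSup fun n => ?_
    have hm := (Lp.stronglyMeasurable (landweber T y n)).measurable
    simp_rw [← Kernel.map_apply _ hX]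
    exact Measurable.lintegral_kernel_prod_right'
      (f := fun q : 𝒮 × α => ‖landweber T y n (q.2, q.1)‖ₑ ^ 2) (by fun_prop)
  have hland : ∀ᵐ s ∂(ν.map S), ∀ n, fiberL2 (landweber T y n) s
      = landweber (condExpOp (fiberMeasure ν S s) hX hY) (fiberL2 y s) n :=
    ae_all_iff.2 fun n => fiberL2_landweber hS hX hY y n
  have hCeq : ∀ᵐ s ∂(ν.map S), C s = ⨆ n, ‖fiberL2 (landweber T y n) s‖ₑ ^ 2 := by
    filter_upwards [ae_all_iff.2 fun n => enorm_fiberL2_sq hS hX (landweber T y n)] with s hs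
    simp_rw [hs, hC]
  have hCfin : ∀ᵐ s ∂(ν.map S), C s ≠ ∞ := by
    filter_upwards [hCeq, hland, hsolv] with s h1 h2 ⟨x, hx⟩
    have : C s ≤ ‖(2 * ‖x‖) ^ 2‖ₑ := by
      rw [h1]
      refine iSup_le fun n => ?_
      rw [h2, ← hx, enorm_pow]
      gcongr
      rw [← ofReal_norm, ← ofReal_norm]
      exact ENNReal.ofReal_le_ofReal
        ((norm_landweber_apply_le (norm_condExpOp_le _ _ _) x n).trans (le_abs_self _))
    exact (this.trans_lt enorm_lt_top).ne
  -- Chosen so that `g ≤ 1`, which keeps `g y` in `L²`, and `g² C ≤ 1`, which bounds the rescaled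
  -- iterates.
  set g : 𝒮 → ℝ := fun s => (1 + (C s).toReal)⁻¹ with hg
  have hgm : Measurable g := by fun_prop
  have hgpos : ∀ s, 0 < g s := fun s => by positivity
  have hgle : ∀ s, g s ≤ 1 := fun s => inv_le_one_of_one_le₀ (by simp)
  have hym : Measurable y := (Lp.stronglyMeasurable _).measurable
  have hgy : MemLp (fun p : β × 𝒮 => g p.2 * y p) 2 (ν.map fun ω => (Y ω, S ω)) := by
    refine (Lp.memLp y).mono (by fun_prop) (Filter.Eventually.of_forall fun p => ?_)
    rw [norm_mul, Real.norm_of_nonneg (hgpos _).le]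
    exact mul_le_of_le_one_left (norm_nonneg _) (hgle _)
  set y' := hgy.toLp _ with hy'
  have hfib : ∀ᵐ s ∂(ν.map S), fiberL2 y' s = g s • fiberL2 y s := by
    filter_upwards [fiberL2_of_ae_eq hS hY y' hgy.coeFn_toLp, fiberL2_ae_eq hS hY y] with s h1 h2
    refine Lp.ext (h1.trans ?_)
    filter_upwards [h2, Lp.coeFn_smul (g s) (fiberL2 y s)] with x e2 e3
    rw [e3, Pi.smul_apply, e2, smul_eq_mul]
  -- The iteration is homogeneous in the right-hand side, so its fiber at `s` is scaled by `g s`;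
  -- integrating `g² C ≤ 1` gives the total mass.
  have hbound : ∀ n, ‖landweber T y' n‖ₑ ^ 2 ≤ ν.map S Set.univ := fun n => by
    rw [lintegral_enorm_fiberL2_sq hS hX, ← lintegral_one]
    refine lintegral_mono_ae ?_
    filter_upwards [fiberL2_landweber hS hX hY y' n, hfib, hland, hCeq, hCfin]
      with s h1 h2 h3 h4 h5
    rw [h1, h2, landweber_smul, ← h3, enorm_smul, mul_pow]
    have hle : ‖fiberL2 (landweber T y n) s‖ₑ ^ 2 ≤ ENNReal.ofReal (C s).toReal := by
      rw [ENNReal.ofReal_toReal h5, h4]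
      exact le_iSup (fun n => ‖fiberL2 (landweber T y n) s‖ₑ ^ 2) n
    refine (mul_le_mul_right hle _).trans ?_
    rw [← enorm_pow, ← ofReal_norm, Real.norm_of_nonneg (by positivity),
      ← ENNReal.ofReal_mul (by positivity), ← ENNReal.ofReal_one]
    refine ENNReal.ofReal_le_ofReal ?_
    have hc : 0 ≤ (C s).toReal := ENNReal.toReal_nonneg
    simp only [hg]
    rw [inv_pow, inv_mul_le_iff₀ (by positivity)]
    nlinarith
  obtain ⟨x, hx⟩ := exists_apply_eq_of_landweber_bounded (norm_condExpOp_le _ _ _)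
    (T := T) (fun k hk => condExpOp_injective_of_fiber hS hY hX hinj k
      (by rwa [adjoint_condExpOp] at hk)) y' (C := Real.sqrt (ν.map S Set.univ).toReal) (fun n => by
      refine Real.le_sqrt_of_sq_le ?_
      have := ENNReal.toReal_mono (measure_ne_top _ _) (hbound n)
      simpa using this)
  refine ⟨g, hgm, hgpos, x, ?_⟩
  rw [hx]
  exact hgy.coeFn_toLp

theorem exists_condMean_eq_of_fiber (hS : Measurable S) {X : Ω → α} {Y : Ω → β}
    (hX : Measurable X) (hY : Measurable Y) {R : Ω → ℝ} (hR : Measurable R) (hR2 : MemLp R 2 ν)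
    (hinj : ∀ᵐ s ∂(ν.map S), ∀ k, condExpOp (fiberMeasure ν S s) hY hX k = 0 → k = 0)
    (hpicard : ∀ᵐ s ∂(ν.map S), ∃ (ι : Type) (σ : ι → ℝ)
      (φ : ι → Lp ℝ 2 ((fiberMeasure ν S s).map X)) (ψ : ι → Lp ℝ 2 ((fiberMeasure ν S s).map Y)),
      IsSingularSystem (condExpOp (fiberMeasure ν S s) hX hY) σ φ ψ ∧
      Summable fun i => (σ i)⁻¹ ^ 2 *
        |∫ z, condMean (fiberMeasure ν S s) R Y z * ψ i z ∂((fiberMeasure ν S s).map Y)| ^ 2) :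
    ∃ q : α × 𝒮 → ℝ, Measurable q ∧
      (∀ᵐ s ∂(ν.map S), MemLp (fun x => q (x, s)) 2 ((fiberMeasure ν S s).map X)) ∧
      condMean ν (fun ω => q (X ω, S ω)) (fun ω => (Y ω, S ω))
        =ᵐ[ν.map fun ω => (Y ω, S ω)] condMean ν R (fun ω => (Y ω, S ω)) := by
  have hid : MemLp (fun r : ℝ => r) 2 (ν.map R) :=
    (memLp_map_measure_iff (by fun_prop) hR.aemeasurable).2 hR2
  -- The function `E[R | Y, S]` as an `L²` vector: the operator applied to the identity on the law
  -- of `R`.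
  set y := condExpOp ν hR (hY.prodMk hS) (hid.toLp _) with hy
  have hyR : y =ᵐ[ν.map fun ω => (Y ω, S ω)] condMean ν R (fun ω => (Y ω, S ω)) := by
    refine (condExpOp_ae_eq_condMean ν hR (hY.prodMk hS) _).trans (Filter.EventuallyEq.of_eq ?_)
    have h := ae_of_ae_map hR.aemeasurable hid.coeFn_toLp
    exact condMean_congr h _
  have hsolv : ∀ᵐ s ∂(ν.map S), ∃ x, condExpOp (fiberMeasure ν S s) hX hY x = fiberL2 y s := by
    filter_upwards [hinj, hpicard, fiberL2_of_ae_eq hS hY y hyR,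
      condMean_ae_eq_condMean_fiberMeasure (ν := ν) hS hY hR (f := Prod.fst) measurable_fst]
      with s h1 ⟨ι, σ, φ, ψ, hsys, hsum⟩ h3 h4
    refine hsys.exists_apply_eq (fun k hk => h1 k (by rwa [adjoint_condExpOp] at hk)) _
      (hsum.congr fun i => ?_)
    rw [L2.inner_def]
    congr 3
    refine integral_congr_ae ?_
    filter_upwards [h3, h4] with z e3 e4
    rw [e3, e4]
    simp
  obtain ⟨g, hgm, hgpos, x, hx⟩ := exists_condExpOp_ae_eq_mul hS hX hY y hinj hsolv
  have hxm : Measurable x := (Lp.stronglyMeasurable x).measurable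
  have hqm : Measurable fun p : α × 𝒮 => (g p.2)⁻¹ * x p := by fun_prop
  refine ⟨fun p => (g p.2)⁻¹ * x p, hqm, ?_, ?_⟩
  · filter_upwards [ae_memLp_fiberMeasure hS hX hxm (Lp.memLp x)] with s hs
    exact hs.const_mul _
  · have hset : MeasurableSet {v | condMean ν (fun ω => (g (S ω))⁻¹ * x (X ω, S ω))
        (fun ω => (Y ω, S ω)) v = condMean ν R (fun ω => (Y ω, S ω)) v} :=
      measurableSet_eq_fun (measurable_condMean _ _ _) (measurable_condMean _ _ _)
    refine (ae_map_prodMk_iff hS hY hset).2 ?_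
    filter_upwards [ae_ae_of_ae_map_prodMk hS hY hyR, ae_ae_of_ae_map_prodMk hS hY hx,
      condMean_ae_eq_condMean_fiberMeasure (ν := ν) hS hY hX hqm,
      condMean_ae_eq_condMean_fiberMeasure (ν := ν) hS hY hX hxm,
      ae_ae_of_ae_map_prodMk hS hY (condExpOp_ae_eq_condMean ν (hX.prodMk hS) (hY.prodMk hS) x)]
      with s h1 h2 h3 h4 h5
    -- The product `g⁻¹ x` need not be globally integrable, so the factor is pulled out in the
    -- fiber, where it is constant.
    have hlin : ∀ᵐ z ∂((fiberMeasure ν S s).map Y),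
        condMean (fiberMeasure ν S s) (fun ω => (g s)⁻¹ * x (X ω, s)) Y z
          = (g s)⁻¹ * condMean (fiberMeasure ν S s) (fun ω => x (X ω, s)) Y z := by
      filter_upwards [condDistrib_comp Y (μ := fiberMeasure ν S s) (Y := fun ω => x (X ω, s))
        (by fun_prop) (f := fun r : ℝ => (g s)⁻¹ * r) (by fun_prop)] with z hz
      have : (fun ω => (g s)⁻¹ * x (X ω, s)) = (fun r : ℝ => (g s)⁻¹ * r) ∘ fun ω => x (X ω, s) :=
        rfl
      rw [condMean, condMean, this, hz, Kernel.map_apply _ (by fun_prop),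
        integral_map (by fun_prop) (by fun_prop), integral_const_mul]
    filter_upwards [h1, h2, h3, h4, h5, hlin] with z e1 e2 e3 e4 e5 e6
    rw [e3, e6, ← e4, ← e1]
    have := e5.symm.trans e2
    rw [this, inv_mul_cancel_left₀ (hgpos s).ne']

end Existence

/-! ### Tower property and completeness -/

section CondMean

variable {Ω β γ ζ : Type*} [MeasurableSpace Ω] [MeasurableSpace β] [MeasurableSpace γ]
  [MeasurableSpace ζ] {μ : Measure Ω} [IsFiniteMeasure μ]

theorem memLp_condMean {X : Ω → ℝ} (hX : MemLp X 2 μ) {V : Ω → β} (hV : Measurable V) :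
    MemLp (condMean μ X V) 2 (μ.map V) := by
  rw [memLp_map_measure_iff (measurable_condMean μ X V).aestronglyMeasurable hV.aemeasurable]
  exact (memLp_congr_ae (condMean_ae_eq_condExp μ hV (hX.integrable (by norm_num)))).2
    (hX.condExp (by norm_num))

theorem condMean_ae_eq_iff {X X' : Ω → ℝ} {V : Ω → β} (hV : Measurable V)
    (hX : Integrable X μ) (hX' : Integrable X' μ) :
    condMean μ X V =ᵐ[μ.map V] condMean μ X' V ↔
      μ[X | MeasurableSpace.comap V inferInstance]
        =ᵐ[μ] μ[X' | MeasurableSpace.comap V inferInstance] := by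
  rw [Filter.EventuallyEq, ae_map_iff hV.aemeasurable
    (measurableSet_eq_fun (measurable_condMean _ _ _) (measurable_condMean _ _ _))]
  have h1 := condMean_ae_eq_condExp μ hV hX
  have h2 := condMean_ae_eq_condExp μ hV hX'
  exact ⟨fun h => h1.symm.trans (Filter.EventuallyEq.trans h h2),
    fun h => h1.trans (h.trans h2.symm)⟩

/-- The tower property `E[E[G | U] | Z] = E[G | Z]` for `G = f(X)`, when the conditional law of `X`
given `(Z, U)` is a function of `U`. -/
theorem condMean_condMean_ae_eq [StandardBorelSpace γ] [Nonempty γ] {X : Ω → γ}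
    (hX : Measurable X) {Z : Ω → ζ} (hZ : Measurable Z) {U : Ω → β} (hU : Measurable U)
    (hind : ∀ᵐ v ∂(μ.map fun ω => (Z ω, U ω)),
      condDistrib X (fun ω => (Z ω, U ω)) μ v = condDistrib X U μ v.2)
    {f : γ → ℝ} (hf : Measurable f) (hint : Integrable (fun ω => f (X ω)) μ) :
    condMean μ (fun ω => condMean μ (fun ω => f (X ω)) U (U ω)) Z =ᵐ[μ.map Z]
      condMean μ (fun ω => f (X ω)) Z := by
  have hZU : Measurable fun ω => (Z ω, U ω) := by fun_prop
  have hsnd : μ.map U = (μ.map fun ω => (Z ω, U ω)).map Prod.snd := by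
    rw [Measure.map_map (by fun_prop) hZU]
    rfl
  have c1 := condDistrib_comp (mβ := inferInstance) U (μ := μ) hX.aemeasurable hf
  rw [hsnd] at c1
  have c2 := ae_of_ae_map (by fun_prop) c1
  have h1 : ∀ᵐ v ∂(μ.map fun ω => (Z ω, U ω)),
      condMean μ (fun ω => f (X ω)) (fun ω => (Z ω, U ω)) v
        = condMean μ (fun ω => f (X ω)) U v.2 := by
    filter_upwards [hind, c2, condDistrib_comp (fun ω => (Z ω, U ω)) (μ := μ) hX.aemeasurable hf]
      with v e1 e2 e3
    have : (fun ω => f (X ω)) = f ∘ X := rfl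
    rw [condMean, condMean, this, e2, e3, Kernel.map_apply _ hf, Kernel.map_apply _ hf, e1]
  -- Here `E[f(X) | U]` is identified with `E[f(X) | Z, U]`, to which the tower property for `σ(Z) ⊆
  -- σ(Z, U)` applies.
  have h2 : (fun ω => condMean μ (fun ω => f (X ω)) U (U ω)) =ᵐ[μ]
      μ[fun ω => f (X ω) | MeasurableSpace.comap (fun ω => (Z ω, U ω)) inferInstance] := by
    refine Filter.EventuallyEq.trans ?_ (condMean_ae_eq_condExp μ hZU hint)
    filter_upwards [ae_of_ae_map hZU.aemeasurable h1] with ω hω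
    exact hω.symm
  rw [condMean_ae_eq_iff hZ (integrable_condExp.congr h2.symm) hint]
  refine (condExp_congr_ae h2).trans (condExp_condExp_of_le ?_ hZU.comap_le)
  rintro _ ⟨B, hB, rfl⟩
  exact ⟨Prod.fst ⁻¹' B, measurable_fst hB, rfl⟩

theorem ConfoundedBandit.CompleteGiven.condExpOp_injective {α : Type*} [MeasurableSpace α]
    {X : Ω → α} {Y : Ω → β} (h : ConfoundedBandit.CompleteGiven μ X Y)
    (hX : Measurable X) (hY : Measurable Y) (k : Lp ℝ 2 (μ.map X))
    (hk : condExpOp μ hX hY k = 0) : k = 0 := by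
  have h1 := condExpOp_ae_eq_condMean μ hX hY k
  rw [hk] at h1
  exact Lp.ext (((h k (Lp.stronglyMeasurable k).measurable (Lp.memLp k)).1
    (h1.symm.trans (Lp.coeFn_zero _ _ _))).trans (Lp.coeFn_zero _ _ _).symm)

/-- If `U` is complete given `Z`, then the conditional means given `U` are determined by those
given `Z`, for variables whose conditional law given `(Z, U)` is a function of `U`. -/
theorem ConfoundedBandit.CompleteGiven.condMean_ae_eq {γ' : Type*} [MeasurableSpace γ']
    [StandardBorelSpace γ] [Nonempty γ] [StandardBorelSpace γ'] [Nonempty γ'] {U : Ω → β} {Z : Ω → ζ}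
    (h : ConfoundedBandit.CompleteGiven μ U Z) (hU : Measurable U) (hZ : Measurable Z)
    {X : Ω → γ} (hX : Measurable X) {X' : Ω → γ'} (hX' : Measurable X')
    (hind : ∀ᵐ v ∂(μ.map fun ω => (Z ω, U ω)),
      condDistrib X (fun ω => (Z ω, U ω)) μ v = condDistrib X U μ v.2)
    (hind' : ∀ᵐ v ∂(μ.map fun ω => (Z ω, U ω)),
      condDistrib X' (fun ω => (Z ω, U ω)) μ v = condDistrib X' U μ v.2)
    {f : γ → ℝ} (hf : Measurable f) {f' : γ' → ℝ} (hf' : Measurable f')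
    (hm : MemLp (fun ω => f (X ω)) 2 μ) (hm' : MemLp (fun ω => f' (X' ω)) 2 μ)
    (heq : condMean μ (fun ω => f (X ω)) Z =ᵐ[μ.map Z] condMean μ (fun ω => f' (X' ω)) Z) :
    condMean μ (fun ω => f (X ω)) U =ᵐ[μ.map U] condMean μ (fun ω => f' (X' ω)) U := by
  set c := condMean μ (fun ω => f (X ω)) U with hc
  set c' := condMean μ (fun ω => f' (X' ω)) U with hc'
  have hcm : Measurable c := measurable_condMean _ _ _
  have hcm' : Measurable c' := measurable_condMean _ _ _
  have hcL : MemLp c 2 (μ.map U) := memLp_condMean hm hU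
  have hcL' : MemLp c' 2 (μ.map U) := memLp_condMean hm' hU
  have hci : Integrable (fun ω => c (U ω)) μ :=
    (hcL.comp_measurePreserving (hU.measurePreserving μ)).integrable (by norm_num)
  have hci' : Integrable (fun ω => c' (U ω)) μ :=
    (hcL'.comp_measurePreserving (hU.measurePreserving μ)).integrable (by norm_num)
  have t := condMean_condMean_ae_eq hX hZ hU hind hf (hm.integrable (by norm_num))
  have t' := condMean_condMean_ae_eq hX' hZ hU hind' hf' (hm'.integrable (by norm_num))
  have t2 := (condMean_ae_eq_iff hZ hci hci').1 ((t.trans heq).trans t'.symm)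
  have key : condMean μ (fun ω => (c - c') (U ω)) Z =ᵐ[μ.map Z] 0 := by
    have h0 : condMean μ (fun _ => (0 : ℝ)) Z =ᵐ[μ.map Z] 0 := by
      filter_upwards [condDistrib_const (μ := μ) Z (0 : ℝ)] with z hz
      rw [condMean, hz]
      simp [Kernel.deterministic_apply]
    refine ((condMean_ae_eq_iff hZ (hci.sub hci') (integrable_zero _ _ _)).2 ?_).trans h0
    refine (condExp_sub hci hci' _).trans ?_
    filter_upwards [t2, (condExp_zero : μ[(0 : Ω → ℝ) |
      MeasurableSpace.comap Z inferInstance] = 0).eventuallyEq] with ω e1 e2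
    refine Eq.trans ?_ e2.symm
    simp [e1]
  filter_upwards [(h (c - c') (hcm.sub hcm') (hcL.sub hcL')).1 key] with u hu
  exact sub_eq_zero.1 hu

end CondMean

/-! ### Conditional independence given `A = a` and in the fibers -/

section ConditionalIndependence

variable {Ω τ α γ : Type*} [MeasurableSpace Ω] [MeasurableSpace τ] [MeasurableSpace α]
  [MeasurableSpace γ] [StandardBorelSpace γ] [Nonempty γ] {P : Measure Ω} [IsFiniteMeasure P]

/-- The event is determined by `T`, so conditioning on it only restricts and renormalizes the law of
`T`. On `E` the kernel sees `T` through `h T` alone, and uniqueness of conditional laws applies. -/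
theorem condDistrib_cond_ae_eq {T : Ω → τ} (hT : Measurable T) {X : Ω → γ} (hX : Measurable X)
    {E : Set τ} (hE : MeasurableSet E) {h : τ → α} (hh : Measurable h) {κ : Kernel α γ}
    [IsMarkovKernel κ] (hκ : ∀ᵐ t ∂(P.map T), t ∈ E → condDistrib X T P t = κ (h t)) :
    condDistrib X (fun ω => h (T ω)) (cond P (T ⁻¹' E))
      =ᵐ[(cond P (T ⁻¹' E)).map fun ω => h (T ω)] κ := by
  refine condDistrib_ae_eq_of_measure_eq_compProd _ hX.aemeasurable
    (Measure.ext_of_lintegral _ fun f hf => ?_)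
  have hmeas : Measurable fun t => E.indicator (fun t => ∫⁻ x, f (h t, x) ∂(κ (h t))) t :=
    Measurable.indicator ((Measurable.lintegral_kernel_prod_right' (κ := κ)
      (f := fun q : α × γ => f q) hf).comp hh) hE
  rw [Measure.lintegral_compProd hf, lintegral_map hf (by fun_prop),
    lintegral_map (Measurable.lintegral_kernel_prod_right' (κ := κ) hf) (by fun_prop),
    ProbabilityTheory.cond,
    lintegral_smul_measure, lintegral_smul_measure, ← lintegral_indicator (hT hE),
    ← lintegral_indicator (hT hE)]
  congr 1
  calc ∫⁻ ω, (T ⁻¹' E).indicator (fun ω => f (h (T ω), X ω)) ω ∂P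
      = ∫⁻ q, (Prod.fst ⁻¹' E).indicator (fun q : τ × γ => f (h q.1, q.2)) q
          ∂(P.map fun ω => (T ω, X ω)) := by
        rw [lintegral_map (Measurable.indicator (by fun_prop) (measurable_fst hE)) (by fun_prop)]
        rfl
    _ = ∫⁻ t, ∫⁻ x, (Prod.fst ⁻¹' E).indicator (fun q : τ × γ => f (h q.1, q.2)) (t, x)
          ∂(condDistrib X T P t) ∂(P.map T) := by
        rw [← compProd_map_condDistrib hX.aemeasurable, Measure.lintegral_compProd
          (Measurable.indicator (by fun_prop) (measurable_fst hE))]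
    _ = ∫⁻ t, E.indicator (fun t => ∫⁻ x, f (h t, x) ∂(κ (h t))) t ∂(P.map T) := by
        refine lintegral_congr_ae ?_
        filter_upwards [hκ] with t ht
        by_cases htE : t ∈ E
        · simp [Set.indicator, htE, ht htE]
        · simp [Set.indicator, htE]
    _ = _ := by
        rw [lintegral_map hmeas hT]
        rfl

variable {𝒮 𝒰 𝒵 𝒜 : Type*} [MeasurableSpace 𝒮] [MeasurableSpace 𝒰] [MeasurableSpace 𝒵]
  [MeasurableSpace 𝒜] [MeasurableSingletonClass 𝒜]

/-- If the conditional law of `X` given all the variables depends on `(S, U, A)` only, then,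
given `A = a`, the conditional law of `X` given `(Z, U, S)` is the one given `(U, S)`. -/
theorem condDistrib_cond_ae_eq_of_kernel {S : Ω → 𝒮} {U : Ω → 𝒰} {Z : Ω → 𝒵} {A : Ω → 𝒜}
    (hS : Measurable S) (hU : Measurable U) (hZ : Measurable Z)
    {X : Ω → γ} (hX : Measurable X) (a : 𝒜) {T : Ω → τ} (hT : Measurable T)
    {π : τ → ((𝒵 × 𝒰) × 𝒮) × 𝒜} (hπ : Measurable π)
    (hπT : ∀ ω, π (T ω) = (((Z ω, U ω), S ω), A ω))
    {κ : Kernel (𝒰 × 𝒮) γ} [IsMarkovKernel κ]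
    (hκ : ∀ᵐ t ∂(P.map T), (π t).2 = a →
      condDistrib X T P t = κ ((π t).1.1.2, (π t).1.2)) :
    ∀ᵐ v ∂((cond P (A ⁻¹' {a})).map fun ω => ((Z ω, U ω), S ω)),
      condDistrib X (fun ω => ((Z ω, U ω), S ω)) (cond P (A ⁻¹' {a})) v
        = condDistrib X (fun ω => (U ω, S ω)) (cond P (A ⁻¹' {a})) (v.1.2, v.2) := by
  have hE : MeasurableSet {t | (π t).2 = a} :=
    (measurable_snd.comp hπ) (measurableSet_singleton a)
  have hTE : T ⁻¹' {t | (π t).2 = a} = A ⁻¹' {a} := by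
    ext ω
    simp [hπT]
  -- The same kernel `κ` represents the conditional law given `(Z, U, S)` and the one given `(U,
  -- S)`.
  have h1 := condDistrib_cond_ae_eq hT hX hE (h := fun t => (π t).1) (by fun_prop)
    (κ := κ.comap (fun v : (𝒵 × 𝒰) × 𝒮 => (v.1.2, v.2)) (by fun_prop)) hκ
  have h2 := condDistrib_cond_ae_eq hT hX hE (h := fun t => ((π t).1.1.2, (π t).1.2))
    (by fun_prop) hκ
  simp only [hTE, hπT] at h1 h2
  have h3 : (cond P (A ⁻¹' {a})).map (fun ω => (U ω, S ω))
      = ((cond P (A ⁻¹' {a})).map fun ω => ((Z ω, U ω), S ω)).map fun v => (v.1.2, v.2) := by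
    rw [Measure.map_map (by fun_prop) (by fun_prop)]
    rfl
  rw [h3] at h2
  filter_upwards [h1, ae_of_ae_map (by fun_prop) h2] with v e1 e2
  rw [e1, e2]
  rfl

theorem condDistrib_fiberMeasure_ae_eq_of_ae_eq [StandardBorelSpace Ω] [Nonempty Ω]
    [MeasurableSpace.CountablyGenerated 𝒰] [MeasurableSpace.CountablyGenerated 𝒵]
    {S : Ω → 𝒮} {U : Ω → 𝒰} {Z : Ω → 𝒵}
    (hS : Measurable S) (hU : Measurable U) (hZ : Measurable Z) {X : Ω → γ} (hX : Measurable X)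
    (hind : ∀ᵐ v ∂(P.map fun ω => ((Z ω, U ω), S ω)),
      condDistrib X (fun ω => ((Z ω, U ω), S ω)) P v
        = condDistrib X (fun ω => (U ω, S ω)) P (v.1.2, v.2)) :
    ∀ᵐ s ∂(P.map S), ∀ᵐ v ∂((fiberMeasure P S s).map fun ω => (Z ω, U ω)),
      condDistrib X (fun ω => (Z ω, U ω)) (fiberMeasure P S s) v
        = condDistrib X U (fiberMeasure P S s) v.2 := by
  have hZU : Measurable fun ω => (Z ω, U ω) := by fun_prop
  filter_upwards [ae_ae_of_ae_map_prodMk hS hZU hind,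
    condDistrib_ae_eq_condDistrib_fiberMeasure (ν := P) hS hZU hX,
    condDistrib_ae_eq_condDistrib_fiberMeasure (ν := P) hS hU hX] with s h1 h2 h3
  have h4 : (fiberMeasure P S s).map U
      = ((fiberMeasure P S s).map fun ω => (Z ω, U ω)).map Prod.snd := by
    rw [Measure.map_map (by fun_prop) hZU]
    rfl
  rw [h4] at h3
  filter_upwards [h1, h2, ae_of_ae_map (by fun_prop) h3] with v e1 e2 e3
  rw [← e2, e1, e3]

end ConditionalIndependence

/-! ### Application to the bandit -/

namespace ConfoundedBandit

variable {Ω 𝒮 𝒰 𝒵 𝒲 𝒜 : Type*} [MeasurableSpace Ω] [MeasurableSpace 𝒮]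
    [MeasurableSpace 𝒰] [MeasurableSpace 𝒵] [MeasurableSpace 𝒲] [MeasurableSpace 𝒜]
    (M : ConfoundedBandit Ω 𝒮 𝒰 𝒵 𝒲 𝒜)

theorem measurable_R [Countable 𝒜] [MeasurableSingletonClass 𝒜] : Measurable M.R :=
  (measurable_from_prod_countable_right (f := fun p : 𝒜 × Ω => M.Rpot p.1 p.2)
    M.measurable_Rpot).comp (M.measurable_A.prodMk measurable_id)

theorem memLp_PA {f : Ω → ℝ} (hf : MemLp f 2 M.P) (a : 𝒜) : MemLp f 2 (M.PA a) := by
  by_cases h : M.P (M.A ⁻¹' {a}) = 0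
  · rw [PA, cond_eq_zero_of_meas_eq_zero h]
    simp
  · rw [PA, ProbabilityTheory.cond]
    exact (hf.restrict _).smul_measure (ENNReal.inv_ne_top.2 h)

variable {M} [StandardBorelSpace Ω] [Nonempty Ω] [MeasurableSingletonClass 𝒜]

theorem Proximal.condDistrib_W_ae_eq [Countable 𝒜] [StandardBorelSpace 𝒵] [StandardBorelSpace 𝒲]
    [Nonempty 𝒲] (h : M.Proximal) (a : 𝒜) :
    ∀ᵐ v ∂((M.PA a).map fun ω => ((M.Z ω, M.U ω), M.S ω)),
      condDistrib M.W (fun ω => ((M.Z ω, M.U ω), M.S ω)) (M.PA a) v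
        = condDistrib M.W (fun ω => (M.U ω, M.S ω)) (M.PA a) (v.1.2, v.2) := by
  have hne : Nonempty (𝒵 × 𝒜) := Nonempty.map (fun ω => (M.Z ω, M.A ω)) inferInstance
  have hS := M.measurable_S
  have hU := M.measurable_U
  have hZ := M.measurable_Z
  have hA := M.measurable_A
  have hci := (condIndepFun_iff_condDistrib_prod_ae_eq_prodMkRight M.measurable_W
    (hZ.prodMk hA) (hS.prodMk hU)).1 (CondIndepFun.symm h.proxy_indep)
  refine condDistrib_cond_ae_eq_of_kernel hS hU hZ M.measurable_W a
    (T := fun ω => ((M.S ω, M.U ω), M.Z ω, M.A ω)) (by fun_prop)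
    (π := fun t => (((t.2.1, t.1.2), t.1.1), t.2.2)) (by fun_prop) (fun ω => rfl)
    -- Independence from `(Z, A)` jointly lets the law of `W` given `(S, U)` under `P` itself serve
    -- for every `a`.
    (κ := (condDistrib M.W (fun ω => (M.S ω, M.U ω)) M.P).comap Prod.swap measurable_swap) ?_
  filter_upwards [hci] with t ht _
  rw [ht]
  rfl

theorem Proximal.condDistrib_R_ae_eq [Countable 𝒜] [StandardBorelSpace 𝒵]
    (h : M.Proximal) (a : 𝒜) :
    ∀ᵐ v ∂((M.PA a).map fun ω => ((M.Z ω, M.U ω), M.S ω)),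
      condDistrib M.R (fun ω => ((M.Z ω, M.U ω), M.S ω)) (M.PA a) v
        = condDistrib M.R (fun ω => (M.U ω, M.S ω)) (M.PA a) (v.1.2, v.2) := by
  have hne : Nonempty 𝒵 := Nonempty.map M.Z inferInstance
  have hS := M.measurable_S
  have hU := M.measurable_U
  have hZ := M.measurable_Z
  have hA := M.measurable_A
  have hci := (condIndepFun_iff_condDistrib_prod_ae_eq_prodMkRight M.measurable_R
    hZ (hS.prodMk (hU.prodMk hA))).1 (CondIndepFun.symm h.reward_indep)
  refine condDistrib_cond_ae_eq_of_kernel hS hU hZ M.measurable_R a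
    (T := fun ω => ((M.S ω, M.U ω, M.A ω), M.Z ω)) (by fun_prop)
    (π := fun t => (((t.2, t.1.2.1), t.1.1), t.1.2.2)) (by fun_prop) (fun ω => rfl)
    -- Here `A` is one of the conditioning variables, so the kernel is frozen at the action `a`.
    (κ := (condDistrib M.R (fun ω => (M.S ω, M.U ω, M.A ω)) M.P).comap
      (fun v : 𝒰 × 𝒮 => (v.2, v.1, a)) (by fun_prop)) ?_
  filter_upwards [hci] with t ht hta
  rw [ht, Kernel.prodMkRight_apply, Kernel.comap_apply, ← hta]

variable [StandardBorelSpace 𝒮] [StandardBorelSpace 𝒵]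
  [StandardBorelSpace 𝒲] [Countable 𝒜]

theorem exists_isSolution (hR : MemLp M.R 2 M.P) (hcomplete : M.Complete) {lW : Measure 𝒲}
    {lZ : Measure 𝒵} (hregular : M.Regular lW lZ) : ∃ q : 𝒲 → 𝒜 → 𝒮 → ℝ, M.IsSolution q := by
  have key := fun a => exists_condMean_eq_of_fiber (ν := M.PA a) M.measurable_S M.measurable_W
    M.measurable_Z M.measurable_R (M.memLp_PA hR a)
    (by
      filter_upwards [hcomplete.proxy a] with s hs k hk
      exact hs.condExpOp_injective M.measurable_Z M.measurable_W k hk)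
    (by
      filter_upwards [hregular.picard a] with s ⟨ι, _, σ, φ, ψ, h⟩
      exact ⟨ι, σ, φ, ψ, h⟩)
  choose q hqm hq2 hqe using key
  exact ⟨fun w a s => q a (w, s), hqm, hq2, hqe⟩

theorem IsSolution.isOutcomeBridge [StandardBorelSpace 𝒰] (hR : MemLp M.R 2 M.P)
    (hproximal : M.Proximal) (hcomplete : M.Complete) {q : 𝒲 → 𝒜 → 𝒮 → ℝ} (hq : M.IsSolution q) :
    M.IsOutcomeBridge q := by
  have hne : Nonempty 𝒲 := Nonempty.map M.W inferInstance
  have hS := M.measurable_S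
  have hU := M.measurable_U
  have hZ := M.measurable_Z
  have hW := M.measurable_W
  have hRm := M.measurable_R
  refine ⟨hq.measurable, fun a => ?_, fun a => ?_⟩
  · have hqm := hq.measurable a
    -- The `L²` bounds on `q(·, a, s)` need not be integrable in `s`, so integrability is only
    -- checked fiber by fiber.
    refine (ae_map_prodMk_iff hS hU (measurableSet_kernel_integrable
      (f := fun _ x => x) measurable_snd.stronglyMeasurable)).2 ?_
    filter_upwards [condDistrib_comp_ae_eq_condDistrib_fiberMeasure (ν := M.PA a) hS hU hW hqm,
      hq.sq_integrable a] with s h1 h2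
    have hqs : Measurable fun w => q w a s := by fun_prop
    have h3 : Integrable (fun ω => q (M.W ω) a s) (M.PSA s a) :=
      (h2.comp_measurePreserving (hW.measurePreserving _)).integrable (by norm_num)
    have h4 : Integrable (fun p : 𝒰 × ℝ => p.2)
        ((M.PSA s a).map fun ω => (M.U ω, q (M.W ω) a s)) :=
      (integrable_map_measure (by fun_prop) (by fun_prop)).2 h3
    filter_upwards [h1, h4.condDistrib_ae_map (by fun_prop)] with u e1 e2
    rw [e1]
    exact e2
  · have hqm := hq.measurable a
    refine (ae_map_prodMk_iff hS hU (measurableSet_eq_fun (measurable_condMean _ _ _)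
      (measurable_condMean _ _ _))).2 ?_
    have hRs := ae_memLp_fiberMeasure (ν := M.PA a) hS hRm (f := Prod.fst) measurable_fst
      ((memLp_map_measure_iff (by fun_prop) (by fun_prop)).2 (M.memLp_PA hR a))
    filter_upwards [hcomplete.latent a, hq.sq_integrable a, hRs,
      condDistrib_fiberMeasure_ae_eq_of_ae_eq hS hU hZ hW (hproximal.condDistrib_W_ae_eq a),
      condDistrib_fiberMeasure_ae_eq_of_ae_eq hS hU hZ hRm (hproximal.condDistrib_R_ae_eq a),
      ae_ae_of_ae_map_prodMk hS hZ (hq.eqn a),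
      condMean_ae_eq_condMean_fiberMeasure (ν := M.PA a) hS hZ hW hqm,
      condMean_ae_eq_condMean_fiberMeasure (ν := M.PA a) hS hZ hRm (f := Prod.fst) measurable_fst,
      condMean_ae_eq_condMean_fiberMeasure (ν := M.PA a) hS hU hW hqm,
      condMean_ae_eq_condMean_fiberMeasure (ν := M.PA a) hS hU hRm (f := Prod.fst) measurable_fst]
      with s hc hq2 hR2 hiW hiR hE hqZ hRZ hqU hRU
    have hqs : Measurable fun w => q w a s := by fun_prop
    -- In the fiber both `q(W, a, s)` and `R` are square-integrable, so completeness turns equality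
    -- given `Z` into equality given `U`.
    have hgoal := hc.condMean_ae_eq hU hZ hW hRm hiW hiR hqs (f' := fun r => r) measurable_id
      (hq2.comp_measurePreserving (hW.measurePreserving _))
      (hR2.comp_measurePreserving (hRm.measurePreserving _)) (by
        filter_upwards [hE, hqZ, hRZ] with z e1 e2 e3
        exact (e2.symm.trans e1).trans e3)
    filter_upwards [hgoal, hqU, hRU] with u e1 e2 e3
    exact (e2.trans e1).trans e3.symm

end ConfoundedBandit

end

theorem mainTheorem8 {Ω 𝒮 𝒰 𝒵 𝒲 𝒜 : Type*}
    [MeasurableSpace Ω] [StandardBorelSpace Ω] [Nonempty Ω]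
    [MeasurableSpace 𝒮] [StandardBorelSpace 𝒮] [MeasurableSpace 𝒰] [StandardBorelSpace 𝒰]
    [MeasurableSpace 𝒵] [StandardBorelSpace 𝒵] [MeasurableSpace 𝒲] [StandardBorelSpace 𝒲]
    [Finite 𝒜] [MeasurableSpace 𝒜] [MeasurableSingletonClass 𝒜]
    (M : ConfoundedBandit Ω 𝒮 𝒰 𝒵 𝒲 𝒜)
    (lW : Measure 𝒲) [SigmaFinite lW] (lZ : Measure 𝒵) [SigmaFinite lZ]
    (hR : MemLp M.R 2 M.P) (hproximal : M.Proximal) (hcomplete : M.Complete)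
    (hregular : M.Regular lW lZ) :
    (∃ q : 𝒲 → 𝒜 → 𝒮 → ℝ, M.IsSolution q) ∧
      ∀ q : 𝒲 → 𝒜 → 𝒮 → ℝ, M.IsSolution q → M.IsOutcomeBridge q :=
  ⟨M.exists_isSolution hR hcomplete hregular,
    fun _ hq => hq.isOutcomeBridge hR hproximal hcomplete⟩
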